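/- Conventions. A *bounded trace* on a (possibly non-unital) C*-algebra $D$ is a bounded positive linear functional $\tau$ on $D$ with $\tau(x^*x)=\tau(xx^*)$ for all $x\in D$; it is *faithful* if $\tau(x^*x)=0$ implies $x=0$. We say that $D$ *admits a faithful trace* if it has a faithful bounded trace of norm one (for unital $D$: a faithful tracial state). Ideals are closed and two-sided; an ideal $I$ of $A$ is *essential* if $I\cap J\neq 0$ for every non-zero ideal $J$ of $A$. $\mathcal M(I)$ denotes the multiplier algebra. Morita equivalence means strong (Rieffel) Morita equivalence, i.e. the existence of an $A$-$B$-imprimitivity bimodule. $A\otimes B$ is the minimal (spatial) tensor product: for faithful unital representations of $A$ on $H$ and of $B$ on $K$, it is the C*-subalgebra of $B(H\otimes K)$ generated by the operators $a\otimes b$, $a\in A$, $b\in B$. **Proposition.** Let $A$ and $B$ be unital C*-algebras. (i) If $A$ and $B$ are Morita equivalent and $A$ admits a faithful trace, then so does $B$. (ii) The minimal tensor product $A\otimes B$ admits a faithful trace if and only if both $A$ and $B$ do. (iii) If $A\neq 0$, $I$ is an essential ideal of $A$, and $I$ has a faithful bounded trace, then $A$ admits a faithful trace. In particular, a (possibly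 non-unital) C*-algebra $I$ admits a faithful trace if and only if $\mathcal M(I)$ does. (iv) If $I$ is an ideal of $A$ such that both $I$ and $A/I$ admit a faithful trace, then $A$ admits a faithful trace. -/

import Mathlib

open scoped TensorProduct MultiplierAlgebra

/-! ### Traces -/

namespace CStarTrace

/-- A bounded positive linear functional `τ` on a (possibly non-unital) C⋆-algebra `A` with
`τ (x* x) = τ (x x*)` for all `x`. Positivity says that `τ (x* x)` is real
and nonnegative. -/
structure IsBoundedTrace {A : Type*} [NonUnitalCStarAlgebra A] (τ : A →L[ℂ] ℂ) : Prop where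
  re_nonneg : ∀ x : A, 0 ≤ (τ (star x * x)).re
  im_eq_zero : ∀ x : A, (τ (star x * x)).im = 0
  trace : ∀ x : A, τ (star x * x) = τ (x * star x)

/-- A tracial state: a positive trace of norm one. On a unital C⋆-algebra this is a positive trace
taking the value `1` at the unit. -/
structure IsTracialState {A : Type*} [NonUnitalCStarAlgebra A] (τ : A →L[ℂ] ℂ) : Prop
    extends IsBoundedTrace τ where
  norm_eq_one : ‖τ‖ = 1

/-- `τ` is faithful if `τ (x* x) = 0` only for `x = 0`. -/
def IsFaithful {A : Type*} [NonUnitalCStarAlgebra A] (τ : A →L[ℂ] ℂ) : Prop :=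
  ∀ x : A, τ (star x * x) = 0 → x = 0

/-- `A` admits a faithful trace, that is, a faithful tracial state. -/
def HasFaithfulTrace (A : Type*) [NonUnitalCStarAlgebra A] : Prop :=
  ∃ τ : A →L[ℂ] ℂ, IsTracialState τ ∧ IsFaithful τ

/-- `A` admits a faithful bounded positive trace (of arbitrary norm). -/
def HasFaithfulBoundedTrace (A : Type*) [NonUnitalCStarAlgebra A] : Prop :=
  ∃ τ : A →L[ℂ] ℂ, IsBoundedTrace τ ∧ IsFaithful τ

end CStarTrace

/-! ### Morita equivalence -/

namespace CStarTrace

/-- An `A`-`B`-imprimitivity bimodule structure on `X`: `X` is an `A`-`B`-bimodule (the right action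
of `B` being written as an action of `Bᵐᵒᵖ`), with an `A`-valued inner product `inA`, linear in the
first variable, and a `B`-valued inner product `inB`, linear in the second variable, which make it a
full left Hilbert `A`-module and a full right Hilbert `B`-module, such that each algebra acts by
adjointable operators for the other inner product and `⟨x, y⟩_A z = x ⟨y, z⟩_B`.
In a C⋆-algebra the positive elements are exactly those of the form `a* a`. -/
structure ImprimitivityBimodule (A B X : Type*) [CStarAlgebra A] [CStarAlgebra B]
    [NormedAddCommGroup X] [NormedSpace ℂ X] [CompleteSpace X] [Module A X] [Module Bᵐᵒᵖ X]
    [IsScalarTower ℂ A X] [IsScalarTower ℂ Bᵐᵒᵖ X] [SMulCommClass A Bᵐᵒᵖ X] where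
  /-- the `A`-valued inner product -/
  inA : X → X → A
  inA_add_left : ∀ x y z, inA (x + y) z = inA x z + inA y z
  inA_smul_left : ∀ (a : A) x y, inA (a • x) y = a * inA x y
  star_inA : ∀ x y, star (inA x y) = inA y x
  inA_self_nonneg : ∀ x, ∃ a : A, inA x x = star a * a
  norm_sq_eq_inA : ∀ x, ‖x‖ ^ 2 = ‖inA x x‖
  full_inA : Dense (Submodule.span ℂ {a : A | ∃ x y, a = inA x y} : Set A)
  /-- the `B`-valued inner product -/
  inB : X → X → B
  inB_add_right : ∀ x y z, inB x (y + z) = inB x y + inB x z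
  inB_smul_right : ∀ (b : B) x y, inB x (MulOpposite.op b • y) = inB x y * b
  star_inB : ∀ x y, star (inB x y) = inB y x
  inB_self_nonneg : ∀ x, ∃ b : B, inB x x = star b * b
  norm_sq_eq_inB : ∀ x, ‖x‖ ^ 2 = ‖inB x x‖
  full_inB : Dense (Submodule.span ℂ {b : B | ∃ x y, b = inB x y} : Set B)
  inB_adjoint : ∀ (a : A) x y, inB (a • x) y = inB x (star a • y)
  inA_adjoint : ∀ (b : B) x y,
    inA (MulOpposite.op b • x) y = inA x (MulOpposite.op (star b) • y)
  inA_smul_eq_smul_inB : ∀ x y z, inA x y • z = MulOpposite.op (inB y z) • x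

universe u v w

/-- (Strong) Morita equivalence of C⋆-algebras: there is an imprimitivity bimodule. -/
def MoritaEquivalent (A : Type u) (B : Type v) [CStarAlgebra A] [CStarAlgebra B] : Prop :=
  ∃ (X : Type w) (_ : NormedAddCommGroup X) (_ : NormedSpace ℂ X) (_ : CompleteSpace X)
    (_ : Module A X) (_ : Module Bᵐᵒᵖ X) (_ : IsScalarTower ℂ A X) (_ : IsScalarTower ℂ Bᵐᵒᵖ X)
    (_ : SMulCommClass A Bᵐᵒᵖ X), Nonempty (ImprimitivityBimodule A B X)

end CStarTrace

/-! ### The minimal tensor product -/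

namespace CStarTrace

section MinTensor

variable {A B H K : Type*} [CStarAlgebra A] [CStarAlgebra B]
  [NormedAddCommGroup H] [InnerProductSpace ℂ H]
  [NormedAddCommGroup K] [InnerProductSpace ℂ K]

/-- The Hilbert space tensor product of `H` and `K`: the completion of the algebraic one. -/
def HilbertTensor (H K : Type*) [NormedAddCommGroup H] [InnerProductSpace ℂ H]
    [NormedAddCommGroup K] [InnerProductSpace ℂ K] : Type _ :=
  UniformSpace.Completion (H ⊗[ℂ] K)

noncomputable instance (H K : Type*) [NormedAddCommGroup H] [InnerProductSpace ℂ H]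
    [NormedAddCommGroup K] [InnerProductSpace ℂ K] : NormedAddCommGroup (HilbertTensor H K) :=
  inferInstanceAs (NormedAddCommGroup (UniformSpace.Completion (H ⊗[ℂ] K)))

noncomputable instance (H K : Type*) [NormedAddCommGroup H] [InnerProductSpace ℂ H]
    [NormedAddCommGroup K] [InnerProductSpace ℂ K] : InnerProductSpace ℂ (HilbertTensor H K) :=
  inferInstanceAs (InnerProductSpace ℂ (UniformSpace.Completion (H ⊗[ℂ] K)))

instance (H K : Type*) [NormedAddCommGroup H] [InnerProductSpace ℂ H]
    [NormedAddCommGroup K] [InnerProductSpace ℂ K] : CompleteSpace (HilbertTensor H K) :=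
  inferInstanceAs (CompleteSpace (UniformSpace.Completion (H ⊗[ℂ] K)))

/-- The operator `S ⊗ T` on the Hilbert space tensor product. -/
noncomputable def opTensor (S : H →L[ℂ] H) (T : K →L[ℂ] K) :
    HilbertTensor H K →L[ℂ] HilbertTensor H K :=
  (TensorProduct.mapL S T).completion

/-- The elementary tensor `x ⊗ y` in the Hilbert space tensor product. -/
noncomputable def HilbertTensor.tmul (x : H) (y : K) : HilbertTensor H K :=
  ((x ⊗ₜ[ℂ] y : H ⊗[ℂ] K) : UniformSpace.Completion (H ⊗[ℂ] K))

theorem opTensor_tmul (S : H →L[ℂ] H) (T : K →L[ℂ] K) (x : H) (y : K) :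
    opTensor S T (HilbertTensor.tmul x y) = HilbertTensor.tmul (S x) (T y) :=
  ContinuousLinearMap.completion_apply_coe (TensorProduct.mapL S T) (x ⊗ₜ[ℂ] y)

variable [CompleteSpace H] [CompleteSpace K]

/-- The minimal (spatial) tensor product of `A` and `B`, realized in faithful representations `π` of
`A` on `H` and `σ` of `B` on `K`: the C⋆-algebra of operators on the Hilbert space tensor product
generated by the operators `π a ⊗ σ b`. Up to an isomorphism fixing the elementary tensors it does
not depend on the faithful representations. -/
noncomputable def minTensor (π : A →⋆ₐ[ℂ] (H →L[ℂ] H)) (σ : B →⋆ₐ[ℂ] (K →L[ℂ] K)) :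
    StarSubalgebra ℂ (HilbertTensor H K →L[ℂ] HilbertTensor H K) :=
  (StarAlgebra.adjoin ℂ
    {T : HilbertTensor H K →L[ℂ] HilbertTensor H K |
      ∃ (a : A) (b : B), T = opTensor (π a) (σ b)}).topologicalClosure

instance isClosed_minTensor (π : A →⋆ₐ[ℂ] (H →L[ℂ] H)) (σ : B →⋆ₐ[ℂ] (K →L[ℂ] K)) :
    IsClosed (minTensor π σ : Set (HilbertTensor H K →L[ℂ] HilbertTensor H K)) :=
  StarSubalgebra.isClosed_topologicalClosure _

end MinTensor

end CStarTrace

/-! ### Closed two-sided ideals and quotients -/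

namespace CStarTrace

section Ideals

variable {A : Type*} [CStarAlgebra A]

/-- Approximate units of closed ideals, for one element. -/
theorem exists_approx (I : Ideal A) [I.IsTwoSided] {x : A} (hx : x ∈ I) {ε : ℝ} (hε : 0 < ε) :
    ∃ e ∈ I, IsSelfAdjoint e ∧ ‖1 - e‖ ≤ 1 ∧ ‖x * (1 - e)‖ ≤ ε := by
  set h : A := star x * x with hh
  have hsa : IsSelfAdjoint h := IsSelfAdjoint.star_mul_self x
  have hI : h ∈ I := I.mul_mem_left _ hx
  set δ : ℝ := ε ^ 2 with hδ
  have hδ0 : 0 < δ := by positivity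
  have hpos : ∀ t : ℝ, 0 < |t| + δ := fun t => by positivity
  have hg : Continuous fun t : ℝ => (|t| + δ)⁻¹ :=
    Continuous.inv₀ (by fun_prop) fun t => (hpos t).ne'
  have hk : Continuous fun t : ℝ => 1 - t * (|t| + δ)⁻¹ := by fun_prop
  have he : cfc (fun t : ℝ => t * (|t| + δ)⁻¹) h = cfc (fun t : ℝ => (|t| + δ)⁻¹) h * h := by
    have h1 := cfc_mul (fun t : ℝ => (|t| + δ)⁻¹) (fun t : ℝ => t) h hg.continuousOn
      continuousOn_id
    rw [cfc_id' ℝ h] at h1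
    rw [← h1]
    exact cfc_congr fun t _ => mul_comm _ _
  have h1e : 1 - cfc (fun t : ℝ => t * (|t| + δ)⁻¹) h
      = cfc (fun t : ℝ => 1 - t * (|t| + δ)⁻¹) h := by
    rw [cfc_sub (fun _ : ℝ => (1 : ℝ)) (fun t : ℝ => t * (|t| + δ)⁻¹) h (by fun_prop)
      (by fun_prop), cfc_const_one ℝ h]
  have hspec : ∀ t ∈ spectrum ℝ h, 0 ≤ t := by
    let _ := CStarAlgebra.spectralOrder A
    have := CStarAlgebra.spectralOrderedRing A
    intro t ht
    exact spectrum_nonneg_of_nonneg (star_mul_self_nonneg x) ht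
  have hk1 : ∀ t : ℝ, 0 ≤ t → 1 - t * (|t| + δ)⁻¹ = δ * (t + δ)⁻¹ := fun t ht => by
    have := hpos t
    rw [abs_of_nonneg ht] at this ⊢
    field_simp
    ring
  refine ⟨cfc (fun t : ℝ => t * (|t| + δ)⁻¹) h, ?_, cfc_predicate _ _, ?_, ?_⟩
  · rw [he]
    exact I.mul_mem_left _ hI
  · rw [h1e]
    refine norm_cfc_le zero_le_one fun t ht => ?_
    have ht0 := hspec t ht
    rw [hk1 t ht0, Real.norm_of_nonneg (by positivity), ← div_eq_mul_inv,
      div_le_one (by positivity)]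
    linarith
  · have hs : star (1 - cfc (fun t : ℝ => t * (|t| + δ)⁻¹) h)
        = cfc (fun t : ℝ => 1 - t * (|t| + δ)⁻¹) h := by
      rw [h1e]
      exact (cfc_predicate (R := ℝ) (p := IsSelfAdjoint) (fun t : ℝ => 1 - t * (|t| + δ)⁻¹) h)
    have hsq : ‖x * (1 - cfc (fun t : ℝ => t * (|t| + δ)⁻¹) h)‖ ^ 2 ≤ ε ^ 2 := by
      rw [sq, ← CStarRing.norm_star_mul_self, star_mul, hs, h1e, mul_assoc, ← mul_assoc (star x),
        ← hh]
      have hm1 := cfc_mul (fun t : ℝ => t) (fun t : ℝ => 1 - t * (|t| + δ)⁻¹) h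
        continuousOn_id hk.continuousOn
      have hm2 := cfc_mul (fun t : ℝ => 1 - t * (|t| + δ)⁻¹)
        (fun t : ℝ => t * (1 - t * (|t| + δ)⁻¹)) h hk.continuousOn (by fun_prop)
      rw [cfc_id' ℝ h] at hm1
      rw [hm1] at hm2
      rw [← hm2]
      refine norm_cfc_le (by positivity) fun t ht => ?_
      have ht0 := hspec t ht
      have htd : 0 < t + δ := by positivity
      rw [hk1 t ht0, Real.norm_of_nonneg (by positivity), ← hδ]
      have : δ * (t + δ)⁻¹ * (t * (δ * (t + δ)⁻¹)) = δ * (δ * t / (t + δ) ^ 2) := by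
        field_simp
      rw [this]
      refine mul_le_of_le_one_right hδ0.le ?_
      rw [div_le_one (by positivity)]
      nlinarith [sq_nonneg t, sq_nonneg δ, mul_nonneg ht0 hδ0.le]
    exact (sq_le_sq₀ (norm_nonneg _) hε.le).1 hsq

/-- Closed two-sided ideals are self-adjoint. -/
theorem star_mem_ideal (I : Ideal A) [I.IsTwoSided] [hI : IsClosed (I : Set A)] {x : A}
    (hx : x ∈ I) : star x ∈ I := by
  have : star x ∈ closure (I : Set A) := by
    refine Metric.mem_closure_iff.2 fun ε hε => ?_
    obtain ⟨e, heI, hesa, -, hle⟩ := exists_approx I hx (half_pos hε)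
    refine ⟨e * star x, I.mul_mem_right _ heI, ?_⟩
    rw [dist_eq_norm]
    have : star x - e * star x = star (x * (1 - e)) := by
      rw [star_mul, star_sub, star_one, hesa.star_eq, sub_mul, one_mul]
    rw [this, norm_star]
    linarith
  rwa [hI.closure_eq] at this

/-- A closed two-sided ideal, as a closed ⋆-subalgebra; in particular it is a C⋆-algebra. -/
def idealAlgebra (I : Ideal A) [I.IsTwoSided] [IsClosed (I : Set A)] :
    NonUnitalStarSubalgebra ℂ A where
  carrier := I
  add_mem' := I.add_mem
  zero_mem' := I.zero_mem
  mul_mem' := fun _ hb => I.mul_mem_left _ hb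
  smul_mem' := fun c x hx => by
    have : c • x = (algebraMap ℂ A c) * x := Algebra.smul_def c x
    rw [this]
    exact I.mul_mem_left _ hx
  star_mem' := star_mem_ideal I

instance isClosed_idealAlgebra (I : Ideal A) [I.IsTwoSided] [hI : IsClosed (I : Set A)] :
    IsClosed (idealAlgebra I : Set A) := hI

/-- An ideal is essential if it meets every non-zero closed two-sided ideal non-trivially. -/
def IsEssential (I : Ideal A) : Prop :=
  ∀ J : Ideal A, J.IsTwoSided → IsClosed (J : Set A) → I ⊓ J = ⊥ → J = ⊥

/-- The involution of the quotient `A ⧸ I`. -/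
instance quotientStar (I : Ideal A) [I.IsTwoSided] [IsClosed (I : Set A)] : Star (A ⧸ I) where
  star := Quotient.map' star fun x y h => by
    rw [Submodule.quotientRel_def] at h ⊢
    rw [← star_sub]
    exact star_mem_ideal I h

theorem star_mk (I : Ideal A) [I.IsTwoSided] [IsClosed (I : Set A)] (x : A) :
    star (Ideal.Quotient.mk I x) = Ideal.Quotient.mk I (star x) := rfl

instance quotientStarRing (I : Ideal A) [I.IsTwoSided] [IsClosed (I : Set A)] :
    StarRing (A ⧸ I) where
  star_involutive := by
    intro x
    obtain ⟨x, rfl⟩ := Ideal.Quotient.mk_surjective x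
    rw [star_mk, star_mk, star_star]
  star_mul := by
    intro x y
    obtain ⟨x, rfl⟩ := Ideal.Quotient.mk_surjective x
    obtain ⟨y, rfl⟩ := Ideal.Quotient.mk_surjective y
    rw [← map_mul, star_mk, star_mk, star_mk, star_mul, map_mul]
  star_add := by
    intro x y
    obtain ⟨x, rfl⟩ := Ideal.Quotient.mk_surjective x
    obtain ⟨y, rfl⟩ := Ideal.Quotient.mk_surjective y
    rw [← map_add, star_mk, star_mk, star_mk, star_add, map_add]

/-- The quotient norm makes `A ⧸ I` a normed ring. -/
noncomputable instance quotientNormedRing (I : Ideal A) [I.IsTwoSided] [IsClosed (I : Set A)] :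
    NormedRing (A ⧸ I) where
  __ := Submodule.Quotient.normedAddCommGroup I
  __ := Ideal.Quotient.ring I
  norm_mul_le x y := by
    refine le_of_forall_pos_le_add fun ε hε => ?_
    have ht : Filter.Tendsto (fun t : ℝ => (‖x‖ + t) * (‖y‖ + t)) (nhdsWithin 0 (Set.Ioi 0))
        (nhds (‖x‖ * ‖y‖)) := by
      have : Continuous fun t : ℝ => (‖x‖ + t) * (‖y‖ + t) := by fun_prop
      simpa using (this.tendsto 0).mono_left nhdsWithin_le_nhds
    obtain ⟨t, ht1, ht0⟩ := ((ht.eventually (gt_mem_nhds (lt_add_of_pos_right _ hε))).and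
      self_mem_nhdsWithin).exists
    obtain ⟨a, rfl, ha⟩ := Submodule.Quotient.norm_mk_lt x ht0
    obtain ⟨b, rfl, hb⟩ := Submodule.Quotient.norm_mk_lt y ht0
    calc _ ≤ ‖a * b‖ := Submodule.Quotient.norm_mk_le I (a * b)
      _ ≤ ‖a‖ * ‖b‖ := norm_mul_le a b
      _ ≤ _ := mul_le_mul ha.le hb.le (norm_nonneg _) ((norm_nonneg _).trans ha.le)
      _ ≤ _ := ht1.le

/-- The quotient of a unital C⋆-algebra by a closed two-sided ideal is a unital C⋆-algebra. -/
noncomputable instance quotientCStarAlgebra (I : Ideal A) [I.IsTwoSided]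
    [IsClosed (I : Set A)] : CStarAlgebra (A ⧸ I) where
  __ := quotientNormedRing I
  __ := quotientStarRing I
  __ := Ideal.Quotient.algebra (I := I) ℂ
  toCompleteSpace := Submodule.Quotient.completeSpace I
  norm_smul_le c x := (Submodule.Quotient.normedSpace I ℂ).norm_smul_le c x
  star_smul c x := by
    obtain ⟨x, rfl⟩ := Ideal.Quotient.mk_surjective x
    change Ideal.Quotient.mk I (star (c • x)) = Ideal.Quotient.mk I (star c • star x)
    rw [star_smul]
  norm_mul_self_le x := by
    obtain ⟨x, rfl⟩ := Ideal.Quotient.mk_surjective x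
    refine le_of_forall_pos_le_add fun ε hε => ?_
    rw [star_mk, ← map_mul]
    obtain ⟨y, hy, hyn⟩ := Submodule.Quotient.norm_mk_lt (S := I)
      (Ideal.Quotient.mk I (star x * x)) (half_pos hε)
    have hyI : star x * x - y ∈ I := (Submodule.Quotient.eq I).1 hy.symm
    obtain ⟨e, heI, hesa, he1, hle⟩ := exists_approx I hyI (half_pos hε)
    have hstar : star (1 - e) = 1 - e := by rw [star_sub, star_one, hesa.star_eq]
    have hmk : Ideal.Quotient.mk I x = Ideal.Quotient.mk I (x * (1 - e)) := by
      refine (Ideal.Quotient.mk_eq_mk_iff_sub_mem _ _).2 ?_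
      rw [mul_sub, mul_one, sub_sub_cancel]
      exact I.mul_mem_left _ heI
    have h1 : ‖Ideal.Quotient.mk I x‖ ≤ ‖x * (1 - e)‖ := by
      rw [hmk]
      exact Submodule.Quotient.norm_mk_le I _
    have h2 : star (x * (1 - e)) * (x * (1 - e))
        = (1 - e) * y * (1 - e) + (1 - e) * ((star x * x - y) * (1 - e)) := by
      rw [star_mul, hstar]
      noncomm_ring
    have h3 : ‖(1 - e) * y * (1 - e)‖ ≤ ‖y‖ := by
      calc _ ≤ ‖1 - e‖ * ‖y‖ * ‖1 - e‖ :=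
            (norm_mul_le _ _).trans (by gcongr; exact norm_mul_le _ _)
        _ ≤ 1 * ‖y‖ * 1 := by gcongr
        _ = ‖y‖ := by ring
    have h4 : ‖(1 - e) * ((star x * x - y) * (1 - e))‖ ≤ ε / 2 := by
      calc _ ≤ ‖1 - e‖ * ‖(star x * x - y) * (1 - e)‖ := norm_mul_le _ _
        _ ≤ 1 * (ε / 2) := by gcongr
        _ = ε / 2 := one_mul _
    calc _ ≤ ‖x * (1 - e)‖ * ‖x * (1 - e)‖ :=
          mul_le_mul h1 h1 (norm_nonneg _) (norm_nonneg _)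
      _ = ‖star (x * (1 - e)) * (x * (1 - e))‖ := CStarRing.norm_star_mul_self.symm
      _ ≤ ‖y‖ + ε / 2 := by
          rw [h2]
          exact (norm_add_le _ _).trans (add_le_add h3 h4)
      _ ≤ _ := by linarith

end Ideals

end CStarTrace

namespace CStarTrace

open Filter Topology
open scoped ComplexOrder

/-! ### Bounded traces: Cauchy–Schwarz, restriction, normalization -/

section Basic

variable {A D : Type*} [NonUnitalCStarAlgebra A] [NonUnitalCStarAlgebra D]

/-! Since faithful bounded traces on non-zero algebras can be normalized, each part reduces to
building a faithful bounded trace.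

Ideals and multipliers rest on `IsBoundedTrace.exists_extension`. Let `φ` be a Hahn–Banach extension
of a trace `τ` from an ideal. If `e - m = s* s` in the ideal, Cauchy–Schwarz bounds `φ ((e - m) x) =
τ (s* (s x))` by `√τ(e - m) √‖τ‖ ‖x‖`, so the functionals `φ (e ·)` converge in norm along the
approximate unit. The limit is a trace extending `τ`. It is faithful when the ideal has trivial
annihilator; otherwise adding the pullback of a faithful trace on the quotient makes it so.

For Morita equivalence, unitality of `B` and fullness give `xᵢ` with `∑ ⟨xᵢ, xᵢ⟩_B = 1`. The
functional `b ↦ ∑ τ ⟨xᵢ b, xᵢ⟩_A` sends `⟨y, z⟩_B` to `τ ⟨z, y⟩_A`, which yields the trace property.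

For tensor products, the product trace is slicing by `τ_B` followed by `τ_A`. Slices of elements of
`minTensor` stay in the images of `A` and `B`, so positivity and faithfulness can be tested one
factor at a time. Conversely, a trace restricts along `a ↦ a ⊗ 1` and `b ↦ 1 ⊗ b`. -/

theorem IsBoundedTrace.nonneg_star_mul_self {τ : A →L[ℂ] ℂ} (hτ : IsBoundedTrace τ) (x : A) :
    ∃ r : ℝ, 0 ≤ r ∧ τ (star x * x) = r :=
  ⟨_, hτ.re_nonneg x, Complex.ext rfl (by simpa using hτ.im_eq_zero x)⟩

/-- The positive linear functional underlying a bounded trace. -/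
noncomputable def IsBoundedTrace.toPositive [PartialOrder A] [StarOrderedRing A] {τ : A →L[ℂ] ℂ}
    (hτ : IsBoundedTrace τ) : A →ₚ[ℂ] ℂ :=
  PositiveLinearMap.mk₀ (τ : A →ₗ[ℂ] ℂ) fun x hx => by
    obtain ⟨y, rfl⟩ := CStarAlgebra.nonneg_iff_eq_star_mul_self.1 hx
    exact Complex.nonneg_iff.2 ⟨hτ.re_nonneg y, (hτ.im_eq_zero y).symm⟩

/-- The Cauchy–Schwarz inequality. -/
theorem IsBoundedTrace.norm_star_mul_le {τ : A →L[ℂ] ℂ} (hτ : IsBoundedTrace τ) (x y : A) :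
    ‖τ (star x * y)‖ ≤ √(τ (star x * x)).re * √(τ (star y * y)).re := by
  let _ := CStarAlgebra.spectralOrder A
  have := CStarAlgebra.spectralOrderedRing A
  exact norm_inner_le_norm (𝕜 := ℂ) (hτ.toPositive.toPreGNS x) (hτ.toPositive.toPreGNS y)

theorem re_apply_star_mul_self_le {τ : A →L[ℂ] ℂ} (x : A) :
    (τ (star x * x)).re ≤ ‖τ‖ * ‖x‖ ^ 2 := by
  refine (Complex.re_le_norm _).trans ((τ.le_opNorm _).trans_eq ?_)
  rw [CStarRing.norm_star_mul_self, sq]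

theorem isBoundedTrace_of_mul_comm {τ : A →L[ℂ] ℂ}
    (h : ∀ x : A, ∃ r : ℝ, 0 ≤ r ∧ τ (star x * x) = r) (hc : ∀ x y, τ (x * y) = τ (y * x)) :
    IsBoundedTrace τ where
  re_nonneg x := by obtain ⟨r, hr, h⟩ := h x; simpa [h] using hr
  im_eq_zero x := by obtain ⟨r, hr, h⟩ := h x; simp [h]
  trace x := hc _ _

/-- Polarization: the trace identity at `x + y` and at `x + i y` gives two linear relations among
the four mixed terms. -/
theorem IsBoundedTrace.mul_comm {τ : A →L[ℂ] ℂ} (hτ : IsBoundedTrace τ) (x y : A) :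
    τ (x * y) = τ (y * x) := by
  suffices H : ∀ x y : A, τ (star y * x) = τ (x * star y) by simpa using (H y (star x))
  intro x y
  have h0 := hτ.trace x
  have h1 := hτ.trace y
  have h2 := hτ.trace (x + y)
  have h3 := hτ.trace (x + Complex.I • y)
  simp only [star_add, star_smul, add_mul, mul_add, smul_mul_assoc, mul_smul_comm, map_add,
    map_smul, smul_eq_mul, Complex.star_def, Complex.conj_I] at h2 h3
  have h3' : Complex.I * (τ (star x * y) - τ (star y * x) + τ (x * star y) - τ (y * star x)) = 0 := by
    linear_combination h3 - h0 - (-Complex.I * Complex.I) * h1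
  have h4 := (mul_eq_zero.1 h3').resolve_left Complex.I_ne_zero
  linear_combination (h2 - h0 - h1 - h4) / 2

theorem IsBoundedTrace.comp {τ : A →L[ℂ] ℂ} (hτ : IsBoundedTrace τ) (ι : D →⋆ₙₐ[ℂ] A)
    {σ : D →L[ℂ] ℂ} (hσ : ∀ x, σ x = τ (ι x)) : IsBoundedTrace σ where
  re_nonneg x := by simpa [hσ, map_star] using hτ.re_nonneg (ι x)
  im_eq_zero x := by simpa [hσ, map_star] using hτ.im_eq_zero (ι x)
  trace x := by simpa [hσ, map_star] using hτ.trace (ι x)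

theorem HasFaithfulBoundedTrace.comap (h : HasFaithfulBoundedTrace A) (ι : D →⋆ₙₐ[ℂ] A)
    (hι : Function.Injective ι) : HasFaithfulBoundedTrace D := by
  obtain ⟨τ, hτ, hf⟩ := h
  let ιL : D →L[ℂ] A := LinearMap.mkContinuous
    { toFun := ι, map_add' := map_add ι, map_smul' := map_smul ι } 1 fun x => by
      simpa using (NonUnitalStarAlgHom.norm_map ι hι x).le
  refine ⟨τ ∘L ιL, hτ.comp ι fun _ => rfl, fun x hx => hι ?_⟩
  rw [map_zero]
  refine hf _ ?_
  rw [← map_star, ← map_mul]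
  exact hx

theorem HasFaithfulTrace.bounded (h : HasFaithfulTrace A) : HasFaithfulBoundedTrace A :=
  let ⟨τ, hτ, hf⟩ := h
  ⟨τ, hτ.toIsBoundedTrace, hf⟩

theorem HasFaithfulTrace.nontrivial (h : HasFaithfulTrace A) : Nontrivial A := by
  obtain ⟨τ, hτ, -⟩ := h
  by_contra hA
  rw [not_nontrivial_iff_subsingleton] at hA
  have h1 : τ = 0 := by
    ext x
    rw [Subsingleton.elim x 0, map_zero, map_zero]
  have := hτ.norm_eq_one
  simp [h1] at this

/-- A faithful bounded trace on a non-zero algebra can be normalized. -/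
theorem HasFaithfulBoundedTrace.normalize [Nontrivial A] (h : HasFaithfulBoundedTrace A) :
    HasFaithfulTrace A := by
  obtain ⟨τ, hτ, hf⟩ := h
  have h0 : τ ≠ 0 := by
    rintro rfl
    obtain ⟨x, hx⟩ := exists_ne (0 : A)
    exact hx (hf x (by simp))
  have hn : 0 < ‖τ‖⁻¹ := inv_pos.2 (norm_pos_iff.2 h0)
  refine ⟨((‖τ‖⁻¹ : ℝ) : ℂ) • τ, ⟨⟨fun x => ?_, fun x => ?_, fun x => ?_⟩, ?_⟩, fun x hx => ?_⟩
  · have := hτ.re_nonneg x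
    simp only [smul_apply, smul_eq_mul, Complex.re_ofReal_mul]
    positivity
  · simp only [smul_apply, smul_eq_mul, Complex.im_ofReal_mul, hτ.im_eq_zero,
      mul_zero]
  · simp only [smul_apply, hτ.trace x]
  · rw [norm_smul, Complex.norm_real, Real.norm_of_nonneg hn.le,
      inv_mul_cancel₀ (norm_pos_iff.2 h0).ne']
  · refine hf x ?_
    simpa [hn.ne', h0] using hx

end Basic

/-- Functionals extend along linear isometries. -/
theorem exists_extension_of_isometry {E F : Type*} [NormedAddCommGroup E] [NormedSpace ℂ E]
    [NormedAddCommGroup F] [NormedSpace ℂ F] (ι : E →ₗᵢ[ℂ] F) (f : E →L[ℂ] ℂ) :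
    ∃ g : F →L[ℂ] ℂ, ∀ x, g (ι x) = f x := by
  obtain ⟨g, hg, -⟩ := exists_extension_norm_eq (LinearMap.range ι.toLinearMap)
    (f ∘L (ι.equivRange.symm.toContinuousLinearEquiv : _ →L[ℂ] E))
  refine ⟨g, fun x => ?_⟩
  have := hg (ι.equivRange x)
  simpa using this

/-- Functionals extend along injective ⋆-homomorphisms. -/
theorem exists_extension_of_injective {A D : Type*} [NonUnitalCStarAlgebra A]
    [NonUnitalCStarAlgebra D] (ι : D →⋆ₙₐ[ℂ] A) (hι : Function.Injective ι) (f : D →L[ℂ] ℂ) :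
    ∃ g : A →L[ℂ] ℂ, ∀ x, g (ι x) = f x :=
  exists_extension_of_isometry
    { toFun := ι, map_add' := map_add ι, map_smul' := map_smul ι,
      norm_map' := NonUnitalStarAlgHom.norm_map ι hι } f

/-! ### Extending a trace from an ideal, given as an injection with ideal range -/

section Extension

variable {A J : Type*} [CStarAlgebra A] [NonUnitalCStarAlgebra J]

theorem exists_eq_mul_right {ι : J →⋆ₙₐ[ℂ] A} (hI : ∀ a j, ∃ j', ι j' = a * ι j) (j : J) (a : A) :
    ∃ j', ι j' = ι j * a := by
  obtain ⟨k, hk⟩ := hI (star a) (star j)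
  exact ⟨star k, by rw [map_star, hk, star_mul, star_star, map_star, star_star]⟩

/-- Since `s x` lies in the ideal, `φ (s* s x) = τ (s* (s x))`, and Cauchy–Schwarz for `τ` applies
although `φ` need not be positive. With `s* s = e - m` this controls the approximating functionals.
-/
theorem norm_apply_mul_le {ι : J →⋆ₙₐ[ℂ] A} (hι : Function.Injective ι)
    (hI : ∀ a j, ∃ j', ι j' = a * ι j) {τ : J →L[ℂ] ℂ} (hτ : IsBoundedTrace τ) {φ : A →L[ℂ] ℂ}
    (hφ : ∀ j, φ (ι j) = τ j) (s : J) (hs : ‖s‖ ≤ 1) (x : A) :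
    ‖φ (ι (star s * s) * x)‖ ≤ √(τ (star s * s)).re * √‖τ‖ * ‖x‖ := by
  obtain ⟨y, hy⟩ := exists_eq_mul_right hI s x
  have h1 : ι (star s * s) * x = ι (star s * y) := by
    rw [map_mul, map_mul, hy, mul_assoc]
  have h2 : ‖y‖ ≤ ‖x‖ := by
    rw [← NonUnitalStarAlgHom.norm_map ι hι y, hy]
    refine (norm_mul_le _ _).trans ?_
    rw [NonUnitalStarAlgHom.norm_map ι hι]
    exact mul_le_of_le_one_left (norm_nonneg _) hs
  rw [h1, hφ, mul_assoc]
  refine (hτ.norm_star_mul_le s y).trans (mul_le_mul_of_nonneg_left ?_ (Real.sqrt_nonneg _))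
  rw [← Real.sqrt_sq (norm_nonneg x), ← Real.sqrt_mul (norm_nonneg _)]
  refine Real.sqrt_le_sqrt ((re_apply_star_mul_self_le y).trans ?_)
  gcongr

/-- For `j` replaced by `e j`, the element `a e` is in the ideal, so `φ (a e j) = τ (j (a e)) = τ
((j a) e)`. Letting `e` run through an approximate unit gives the claim; no trace property of `φ` is
needed. -/
theorem apply_mul_comm {ι : J →⋆ₙₐ[ℂ] A} (hι : Function.Injective ι)
    (hI : ∀ a j, ∃ j', ι j' = a * ι j) {τ : J →L[ℂ] ℂ} (hτ : IsBoundedTrace τ) {φ : A →L[ℂ] ℂ}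
    (hφ : ∀ j, φ (ι j) = τ j) (a : A) (j : J) : φ (a * ι j) = φ (ι j * a) := by
  let _ := CStarAlgebra.spectralOrder J
  have := CStarAlgebra.spectralOrderedRing J
  have hl := CStarAlgebra.increasingApproximateUnit J
  have := hl.neBot
  obtain ⟨v, hv⟩ := exists_eq_mul_right hI j a
  have key : ∀ e, φ (a * ι (e * j)) = τ (v * e) := fun e => by
    obtain ⟨w, hw⟩ := hI a e
    calc φ (a * ι (e * j)) = φ (ι (w * j)) := by rw [map_mul ι, map_mul ι, hw, mul_assoc]
      _ = φ (ι (j * w)) := by rw [hφ, hφ, hτ.mul_comm]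
      _ = φ (ι (v * e)) := by rw [map_mul ι, map_mul ι, hw, hv, mul_assoc]
      _ = τ (v * e) := hφ _
  have hc : Continuous fun j => φ (a * ι j) := by
    have : Continuous ι := (NonUnitalStarAlgHom.isometry ι hι).continuous
    fun_prop
  rw [← hv, hφ]
  refine tendsto_nhds_unique ((hc.tendsto _).comp (hl.tendsto_mul_right j)) ?_
  exact ((τ.continuous.tendsto _).comp (hl.tendsto_mul_left v)).congr fun e => (key e).symm

end Extension

open Filter Topology

section Extension

variable {A J : Type*} [CStarAlgebra A] [NonUnitalCStarAlgebra J]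

/-- The functionals `φ (e ·)`, where `φ` extends a bounded trace on the ideal, converge in norm
along an increasing approximate unit. -/
theorem exists_tendsto_comp_mul [PartialOrder J] [StarOrderedRing J] {ι : J →⋆ₙₐ[ℂ] A}
    (hι : Function.Injective ι) (hI : ∀ a j, ∃ j', ι j' = a * ι j) {τ : J →L[ℂ] ℂ}
    (hτ : IsBoundedTrace τ) {φ : A →L[ℂ] ℂ} (hφ : ∀ j, φ (ι j) = τ j) :
    ∃ ψ : A →L[ℂ] ℂ, Tendsto (fun e => φ ∘L ContinuousLinearMap.mul ℂ A (ι e))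
      (CStarAlgebra.approximateUnit J) (𝓝 ψ) := by
  have hl := CStarAlgebra.increasingApproximateUnit J
  have := hl.neBot
  have hre : ∀ e : J, ‖e‖ ≤ 1 → (τ e).re ≤ ‖τ‖ := fun e he =>
    (Complex.re_le_norm _).trans ((τ.le_opNorm e).trans (mul_le_of_le_one_right (norm_nonneg _) he))
  set S : Set ℝ := (fun e => (τ e).re) '' {e : J | 0 ≤ e ∧ ‖e‖ ≤ 1} with hS
  have hSne : S.Nonempty := ⟨_, 0, by simp, rfl⟩
  have hSb : BddAbove S := ⟨‖τ‖, by rintro _ ⟨e, he, rfl⟩; exact hre e he.2⟩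
  -- Choose `m` with `τ m` within `δ` of the supremum over the positive unit ball; any larger `e` in
  -- the ball then gains at most `δ`. Scaling by some `r < 1` makes the norm strictly less than one,
  -- as the basis of the approximate-unit filter requires.
  have hnear : ∀ δ > 0, ∃ m : J, 0 ≤ m ∧ ‖m‖ < 1 ∧
      ∀ e, m ≤ e → ‖e‖ ≤ 1 → (τ (e - m)).re ≤ δ := by
    intro δ hδ
    obtain ⟨_, ⟨m, ⟨hm0, hm1⟩, rfl⟩, hm⟩ := exists_lt_of_lt_csSup hSne (sub_lt_self (sSup S) hδ)
    have hlim : Tendsto (fun r : ℝ => r * (τ m).re) (𝓝[<] 1) (𝓝 (τ m).re) := by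
      have : Continuous fun r : ℝ => r * (τ m).re := by fun_prop
      simpa using (this.tendsto 1).mono_left nhdsWithin_le_nhds
    obtain ⟨r, hr, hr1, hr0⟩ := ((hlim.eventually (lt_mem_nhds hm)).and
      (eventually_mem_nhdsWithin.and
        (nhdsWithin_le_nhds (lt_mem_nhds (zero_lt_one' ℝ))))).exists
    refine ⟨r • m, smul_nonneg (le_of_lt hr0) hm0, ?_, fun e he he1 => ?_⟩
    · rw [norm_smul, Real.norm_of_nonneg (le_of_lt hr0)]
      exact (mul_le_of_le_one_right (le_of_lt hr0) hm1).trans_lt hr1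
    · have h1 : (τ e).re ≤ sSup S :=
        le_csSup hSb ⟨e, ⟨(smul_nonneg (le_of_lt hr0) hm0).trans he, he1⟩, rfl⟩
      have h2 : (τ (r • m)).re = r * (τ m).re := by
        rw [← Complex.coe_smul, map_smul, smul_eq_mul, Complex.re_ofReal_mul]
      rw [map_sub, Complex.sub_re, h2]
      linarith
  refine CompleteSpace.complete (Metric.cauchy_iff.2 ⟨inferInstance, fun ε hε => ?_⟩)
  have hδ : ∃ δ > 0, √δ * √‖τ‖ ≤ ε / 4 := by
    have hc : Tendsto (fun δ => √δ * √‖τ‖) (𝓝[>] 0) (𝓝 0) := by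
      have : Continuous fun δ => √δ * √‖τ‖ := by fun_prop
      simpa using (this.tendsto 0).mono_left nhdsWithin_le_nhds
    obtain ⟨δ, h, h0⟩ := ((hc.eventually (gt_mem_nhds (show 0 < ε / 4 by positivity))).and
      self_mem_nhdsWithin).exists
    exact ⟨δ, h0, h.le⟩
  obtain ⟨δ, hδ0, hδ⟩ := hδ
  obtain ⟨m, hm0, hm1, hm⟩ := hnear δ hδ0
  have hdist : ∀ e, m ≤ e → ‖e‖ ≤ 1 → dist (φ ∘L ContinuousLinearMap.mul ℂ A (ι e))
      (φ ∘L ContinuousLinearMap.mul ℂ A (ι m)) ≤ ε / 4 := by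
    intro e he he1
    rw [dist_eq_norm]
    refine ContinuousLinearMap.opNorm_le_bound _ (by positivity) fun x => ?_
    have h0 : 0 ≤ e - m := sub_nonneg.2 he
    have h1 : ‖e - m‖ ≤ 1 :=
      (CStarAlgebra.norm_le_norm_of_nonneg_of_le h0 (sub_le_self e hm0)).trans he1
    obtain ⟨s, hs⟩ := CStarAlgebra.nonneg_iff_eq_star_mul_self.1 h0
    have hs1 : ‖s‖ ≤ 1 := by
      rw [hs, CStarRing.norm_star_mul_self] at h1
      nlinarith [norm_nonneg s]
    have h2 := norm_apply_mul_le hι hI hτ hφ s hs1 x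
    rw [← hs, map_sub, sub_mul, map_sub] at h2
    refine h2.trans (mul_le_mul_of_nonneg_right (le_trans ?_ hδ) (norm_nonneg _))
    gcongr
    exact hm e he he1
  refine ⟨_, image_mem_map ((CStarAlgebra.hasBasis_approximateUnit J).mem_of_mem ⟨hm0, hm1⟩), ?_⟩
  rintro _ ⟨e, ⟨he, he1⟩, rfl⟩ _ ⟨f, ⟨hf, hf1⟩, rfl⟩
  rw [mem_closedBall_zero_iff] at he1 hf1
  refine (dist_triangle_right _ _ (φ ∘L ContinuousLinearMap.mul ℂ A (ι m))).trans_lt ?_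
  linarith [hdist e he he1, hdist f hf hf1]

/-- A bounded trace on an ideal extends to the whole algebra. -/
theorem IsBoundedTrace.exists_extension {ι : J →⋆ₙₐ[ℂ] A}
    (hι : Function.Injective ι) (hI : ∀ a j, ∃ j', ι j' = a * ι j) {τ : J →L[ℂ] ℂ}
    (hτ : IsBoundedTrace τ) : ∃ ψ : A →L[ℂ] ℂ, IsBoundedTrace ψ ∧ ∀ j, ψ (ι j) = τ j := by
  let _ := CStarAlgebra.spectralOrder J
  have := CStarAlgebra.spectralOrderedRing J
  obtain ⟨φ, hφ⟩ := exists_extension_of_injective ι hι τ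
  obtain ⟨ψ, hψ⟩ := exists_tendsto_comp_mul hι hI hτ hφ
  have hl := CStarAlgebra.increasingApproximateUnit J
  have := hl.neBot
  set l := CStarAlgebra.approximateUnit J
  have hιc : Continuous ι := (NonUnitalStarAlgHom.isometry ι hι).continuous
  have happ : ∀ x, Tendsto (fun e => φ (ι e * x)) l (𝓝 (ψ x)) := fun x =>
    ((ContinuousLinearMap.apply ℂ ℂ x).continuous.tendsto ψ).comp hψ
  have hext : ∀ j, ψ (ι j) = τ j := fun j => by
    refine tendsto_nhds_unique (happ _) ?_
    refine ((τ.continuous.tendsto _).comp (hl.tendsto_mul_right j)).congr fun e => ?_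
    rw [Function.comp_apply, ← hφ, map_mul ι]
  refine ⟨ψ, isBoundedTrace_of_mul_comm (fun x => ?_) fun a b => ?_, hext⟩
  · have hcl : IsClosed {z : ℂ | ∃ r : ℝ, 0 ≤ r ∧ z = r} := by
      have : {z : ℂ | ∃ r : ℝ, 0 ≤ r ∧ z = r} = {z : ℂ | 0 ≤ z.re} ∩ {z : ℂ | z.im = 0} := by
        ext z
        constructor
        · rintro ⟨r, hr, rfl⟩
          exact ⟨by simpa using hr, by simp⟩
        · rintro ⟨h1, h2⟩
          exact ⟨z.re, h1, Complex.ext rfl (by simpa using h2)⟩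
      rw [this]
      exact (isClosed_le continuous_const Complex.continuous_re).inter
        (isClosed_eq Complex.continuous_im continuous_const)
    refine hcl.mem_of_tendsto (happ _) ?_
    filter_upwards [hl.eventually_nonneg] with e he
    obtain ⟨s, rfl⟩ := CStarAlgebra.nonneg_iff_eq_star_mul_self.1 he
    obtain ⟨y, hy⟩ := exists_eq_mul_right hI s (star x)
    obtain ⟨v, hv⟩ := exists_eq_mul_right hI (star s * s) (star x)
    -- With `y = s x*`, moving `x` to the front turns `s* s x* x` into `x s* s x* = y* y`, an
    -- element of the ideal.
    have : φ (ι (star s * s) * (star x * x)) = τ (star y * y) := by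
      rw [← mul_assoc, ← hv, ← apply_mul_comm hι hI hτ hφ, hv, ← hφ, map_mul ι, map_mul ι,
        map_star ι, map_star ι, hy, star_mul, star_star, mul_assoc, mul_assoc]
    rw [this]
    exact hτ.nonneg_star_mul_self y
  -- Before the limit, `φ (e a b) = φ (b e a) = ψ (b e a)`, because `e a` and `b e a` lie in the
  -- ideal. It remains to let `e` tend to the unit inside `ψ`.
  · suffices H : Tendsto (fun e => ψ (b * ι e * a)) l (𝓝 (ψ (b * a))) by
      refine tendsto_nhds_unique (happ _) (H.congr fun e => ?_)
      obtain ⟨u, hu⟩ := hI b e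
      obtain ⟨v, hv⟩ := exists_eq_mul_right hI u a
      obtain ⟨w, hw⟩ := exists_eq_mul_right hI e a
      calc ψ (b * ι e * a) = φ (b * ι w) := by rw [← hu, ← hv, hext, ← hφ, hv, hu, hw, mul_assoc]
        _ = φ (ι w * b) := apply_mul_comm hι hI hτ hφ _ _
        _ = φ (ι e * (a * b)) := by rw [hw, mul_assoc]
    refine Metric.tendsto_nhds.2 fun ε hε => ?_
    set C := ‖b‖ * ‖a‖ + 1
    have hC : 0 < C := by positivity
    have hm := Metric.tendsto_nhds.1 hψ (ε / (4 * C)) (by positivity)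
    obtain ⟨m, hm⟩ := hm.exists
    rw [dist_eq_norm, norm_sub_rev] at hm
    -- Norm convergence is essential here: `T` is uniformly close to `ψ` on the ball of radius `C`,
    -- which contains every `b e a` with `‖e‖ ≤ 1`. For `T` the limit is clear, since `m b` lies in
    -- the ideal and `(m b) e → m b`.
    set T := φ ∘L ContinuousLinearMap.mul ℂ A (ι m)
    obtain ⟨v, hv⟩ := exists_eq_mul_right hI m b
    have hT : Tendsto (fun e => T (b * ι e * a)) l (𝓝 (T (b * a))) := by
      have h1 : Tendsto (fun e => φ (ι (v * e) * a)) l (𝓝 (φ (ι v * a))) := by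
        have hc : Continuous fun j => φ (ι j * a) := by fun_prop
        exact (hc.tendsto v).comp (hl.tendsto_mul_left v)
      have hTv : ∀ x, T (b * x) = φ (ι v * x) := fun x => by
        change φ (ι m * (b * x)) = _
        rw [hv, mul_assoc]
      rw [hTv]
      refine h1.congr fun e => ?_
      rw [mul_assoc b, hTv, map_mul ι, mul_assoc]
    have hclose : ∀ x, ‖x‖ ≤ C → ‖ψ x - T x‖ < ε / 3 := fun x hx => by
      calc ‖ψ x - T x‖ ≤ ‖ψ - T‖ * ‖x‖ := (ψ - T).le_opNorm x
        _ ≤ ε / (4 * C) * C := by gcongr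
        _ = ε / 4 := by field_simp
        _ < ε / 3 := by linarith
    filter_upwards [Metric.tendsto_nhds.1 hT (ε / 3) (by positivity), hl.eventually_norm]
      with e he he1
    have h1 : ‖b * ι e * a‖ ≤ C := by
      calc ‖b * ι e * a‖ ≤ ‖b‖ * ‖ι e‖ * ‖a‖ :=
            (norm_mul_le _ _).trans (by gcongr; exact norm_mul_le _ _)
        _ ≤ ‖b‖ * 1 * ‖a‖ := by
            rw [NonUnitalStarAlgHom.norm_map ι hι]
            gcongr
        _ ≤ C := by simp [C]
    have h2 : ‖b * a‖ ≤ C := (norm_mul_le _ _).trans (by simp [C])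
    rw [dist_eq_norm] at he ⊢
    have h3 := hclose _ h1
    have h4 := hclose _ h2
    calc ‖ψ (b * ι e * a) - ψ (b * a)‖
        = ‖(ψ (b * ι e * a) - T (b * ι e * a)) + (T (b * ι e * a) - T (b * a))
            - (ψ (b * a) - T (b * a))‖ := by congr 1; ring
      _ ≤ _ := (norm_sub_le _ _).trans (add_le_add_left (norm_add_le _ _) _)
      _ < ε := by linarith

/-- A faithful bounded trace on an ideal with trivial annihilator extends to a faithful one. -/
theorem HasFaithfulBoundedTrace.extend {ι : J →⋆ₙₐ[ℂ] A}
    (hι : Function.Injective ι) (hI : ∀ a j, ∃ j', ι j' = a * ι j)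
    (hann : ∀ a, (∀ j, a * ι j = 0) → a = 0) (h : HasFaithfulBoundedTrace J) :
    HasFaithfulBoundedTrace A := by
  obtain ⟨τ, hτ, hf⟩ := h
  obtain ⟨ψ, hψ, hext⟩ := hτ.exists_extension hι hI
  refine ⟨ψ, hψ, fun a ha => hann a fun j => ?_⟩
  obtain ⟨k, hk⟩ := hI a j
  rw [← hk, hf k, map_zero]
  rw [← hext, map_mul, map_star, hk]
  -- The trace property brings `a` to the right, so that Cauchy–Schwarz against `ψ (a* a) = 0`
  -- applies.
  have h1 : ψ (star (a * ι j) * (a * ι j)) = ψ (star (a * (ι j * star (ι j))) * a) := by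
    rw [hψ.trace, star_mul, star_mul, star_mul, star_star, mul_assoc, hψ.mul_comm]
    simp only [mul_assoc]
  have h2 := hψ.norm_star_mul_le (a * (ι j * star (ι j))) a
  rw [ha, Complex.zero_re, Real.sqrt_zero, mul_zero, norm_le_zero_iff] at h2
  rw [h1, h2]

end Extension

/-! ### Essential ideals and extensions by quotients -/

section Ideals

variable {A : Type*} [CStarAlgebra A]

theorem idealAlgebra_mul (I : Ideal A) [I.IsTwoSided] [IsClosed (I : Set A)] (a : A)
    (j : idealAlgebra I) : ∃ j' : idealAlgebra I,
      NonUnitalStarSubalgebraClass.subtype (idealAlgebra I) j' =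
        a * NonUnitalStarSubalgebraClass.subtype (idealAlgebra I) j :=
  ⟨⟨a * j, I.mul_mem_left a j.2⟩, rfl⟩

/-- The annihilator of a two-sided ideal. -/
def leftAnnihilator (I : Ideal A) [I.IsTwoSided] : Ideal A where
  carrier := {a | ∀ j ∈ I, a * j = 0}
  add_mem' ha hb j hj := by rw [add_mul, ha j hj, hb j hj, add_zero]
  zero_mem' j _ := zero_mul j
  smul_mem' c a ha j hj := by rw [smul_eq_mul, mul_assoc, ha j hj, mul_zero]

/-- The left annihilator is a closed two-sided ideal. An element `x` of its intersection with `I`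
satisfies `x x* = 0`, so essentiality kills the annihilator. -/
theorem IsEssential.eq_zero_of_mul {I : Ideal A} [I.IsTwoSided] [hI : IsClosed (I : Set A)]
    (h : IsEssential I) {a : A} (ha : ∀ j ∈ I, a * j = 0) : a = 0 := by
  have h1 : (leftAnnihilator I).IsTwoSided :=
    ⟨fun {a} b ha j hj => by rw [mul_assoc]; exact ha _ (I.mul_mem_left b hj)⟩
  have h2 : IsClosed (leftAnnihilator I : Set A) := by
    have : (leftAnnihilator I : Set A) = ⋂ j ∈ I, {a | a * j = 0} := by
      ext a
      simp [leftAnnihilator]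
    rw [this]
    exact isClosed_biInter fun j _ => isClosed_eq (by fun_prop) continuous_const
  have h3 : leftAnnihilator I = ⊥ := h _ h1 h2 <| by
    refine (Submodule.eq_bot_iff _).2 fun x hx => ?_
    exact CStarRing.mul_star_self_eq_zero_iff x |>.1 (hx.2 _ (star_mem_ideal I hx.1))
  exact (Submodule.eq_bot_iff _).1 h3 a ha

theorem hasFaithfulTrace_of_essential [Nontrivial A] (I : Ideal A) [I.IsTwoSided]
    [IsClosed (I : Set A)] (h : IsEssential I) (hI : HasFaithfulBoundedTrace (idealAlgebra I)) :
    HasFaithfulTrace A :=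
  (hI.extend (ι := NonUnitalStarSubalgebraClass.subtype (idealAlgebra I)) Subtype.val_injective
    (idealAlgebra_mul I) fun _ ha => h.eq_zero_of_mul fun j hj => ha ⟨j, hj⟩).normalize

/-- The sum of the extended trace and the pulled-back quotient trace is faithful: if it vanishes at
`x* x`, so do both summands. The second puts `x` in `I`, where the first is the given faithful
trace. -/
theorem hasFaithfulTrace_of_ideal_quotient (I : Ideal A) [I.IsTwoSided]
    [IsClosed (I : Set A)] (hI : HasFaithfulTrace (idealAlgebra I))
    (hQ : HasFaithfulTrace (A ⧸ I)) : HasFaithfulTrace A := by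
  obtain ⟨τ, hτ, hτf⟩ := hI
  obtain ⟨σ, hσ, hσf⟩ := id hQ
  have := hQ.nontrivial
  have : Nontrivial A := (Ideal.Quotient.mk_surjective (I := I)).nontrivial
  obtain ⟨ψ, hψ, hext⟩ := hτ.toIsBoundedTrace.exists_extension
    (ι := NonUnitalStarSubalgebraClass.subtype (idealAlgebra I)) Subtype.val_injective
    (idealAlgebra_mul I)
  let q : A →⋆ₙₐ[ℂ] A ⧸ I :=
    { toFun := Ideal.Quotient.mk I
      map_smul' := fun _ _ => rfl
      map_zero' := map_zero _
      map_add' := map_add _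
      map_mul' := map_mul _
      map_star' := fun _ => rfl }
  let qL : A →L[ℂ] A ⧸ I := LinearMap.mkContinuous
    { toFun := q, map_add' := map_add q, map_smul' := map_smul q } 1 fun x => by
      simpa using NonUnitalStarAlgHom.norm_apply_le q x
  have hq : IsBoundedTrace (σ ∘L qL) := hσ.toIsBoundedTrace.comp q fun _ => rfl
  refine HasFaithfulBoundedTrace.normalize ⟨ψ + σ ∘L qL,
    ⟨fun x => ?_, fun x => ?_, fun x => ?_⟩, fun x hx => ?_⟩
  · exact add_nonneg (hψ.re_nonneg x) (hq.re_nonneg x)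
  · rw [add_apply, Complex.add_im, hψ.im_eq_zero, hq.im_eq_zero, add_zero]
  · rw [add_apply, add_apply, hψ.trace, hq.trace]
  · have hre := congrArg Complex.re hx
    rw [add_apply, Complex.add_re, Complex.zero_re] at hre
    have h1 := hψ.re_nonneg x
    have h2 := hq.re_nonneg x
    have h3 : (σ ∘L qL) (star x * x) = 0 :=
      Complex.ext (by rw [Complex.zero_re]; linarith) (hq.im_eq_zero x)
    have h4 : ψ (star x * x) = 0 :=
      Complex.ext (by rw [Complex.zero_re]; linarith) (hψ.im_eq_zero x)
    have hxI : x ∈ I := Ideal.Quotient.eq_zero_iff_mem.1 (hσf (q x) h3)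
    have := hτf ⟨x, hxI⟩ ((hext _).symm.trans h4)
    exact congrArg Subtype.val this

end Ideals

/-! ### Multiplier algebras -/

theorem eq_of_forall_mul_left {J : Type*} [NonUnitalCStarAlgebra J] {a b : J}
    (h : ∀ y, y * a = y * b) : a = b := by
  rw [← sub_eq_zero, ← CStarRing.star_mul_self_eq_zero_iff, mul_sub, h, sub_self]

/-- `J` sits in its multiplier algebra as an ideal with trivial annihilator, so traces extend;
conversely they restrict. Both facts about `J` follow from the centrality relation between the two
components of a multiplier. -/
theorem hasFaithfulTrace_multiplier_iff (J : Type*) [NonUnitalCStarAlgebra J] :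
    HasFaithfulTrace J ↔ HasFaithfulTrace 𝓜(ℂ, J) := by
  have hinj : Function.Injective (DoubleCentralizer.coeHom (𝕜 := ℂ) (A := J)) := by
    refine (injective_iff_map_eq_zero _).2 fun a ha => ?_
    have h : (a : 𝓜(ℂ, J)).fst (star a) = 0 := by
      change (DoubleCentralizer.coeHom (𝕜 := ℂ) a).fst (star a) = 0
      rw [ha]
      rfl
    rw [DoubleCentralizer.coe_fst] at h
    exact (CStarRing.mul_star_self_eq_zero_iff a).1 h
  constructor
  · intro h
    have := h.nontrivial
    have : Nontrivial 𝓜(ℂ, J) := hinj.nontrivial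
    refine (h.bounded.extend hinj (fun a j => ⟨a.fst j, ?_⟩) fun a ha => ?_).normalize
    · refine DoubleCentralizer.ext ℂ J _ _ (Prod.ext ?_ ?_)
      · ext x
        change a.fst j * x = a.fst (j * x)
        refine eq_of_forall_mul_left fun y => ?_
        rw [← mul_assoc, ← a.central, ← a.central, mul_assoc]
      · ext x
        exact (a.central x j).symm
    · have hsnd : ∀ y j, a.snd y * j = 0 := fun y j =>
        congrArg (fun b : 𝓜(ℂ, J) => b.snd y) (ha j)
      refine DoubleCentralizer.ext ℂ J _ _ (Prod.ext ?_ ?_)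
      · ext j
        refine eq_of_forall_mul_left fun y => ?_
        rw [← a.central, hsnd]
        exact (mul_zero y).symm
      · ext y
        exact (CStarRing.mul_star_self_eq_zero_iff _).1 (hsnd y (star (a.snd y)))
  · intro h
    have : Nontrivial J := by
      have := h.nontrivial
      by_contra hJ
      rw [not_nontrivial_iff_subsingleton] at hJ
      refine zero_ne_one' 𝓜(ℂ, J) (DoubleCentralizer.ext ℂ J _ _ (Prod.ext ?_ ?_)) <;>
      exact Subsingleton.elim _ _
    exact (h.bounded.comap DoubleCentralizer.coeHom hinj).normalize

/-! ### Morita equivalence -/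

theorem exists_star_mul_mul_eq_one {B : Type*} [CStarAlgebra B] [PartialOrder B]
    [StarOrderedRing B] {c : B} (hc : 1 ≤ c) : ∃ d, star d * c * d = 1 := by
  nontriviality B
  have h0 : 0 ≤ c := zero_le_one.trans hc
  have hu : IsUnit c := CStarAlgebra.isUnit_of_le 1 hc
  -- Invertibility of `c` makes its inverse square root available.
  refine ⟨c ^ (-(1 / 2) : ℝ), ?_⟩
  have hd : star (c ^ (-(1 / 2) : ℝ)) = c ^ (-(1 / 2) : ℝ) :=
    (IsSelfAdjoint.of_nonneg CFC.rpow_nonneg).star_eq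
  rw [hd]
  nth_rewrite 2 [← CFC.rpow_one c h0]
  rw [← CFC.rpow_add hu, ← CFC.rpow_add hu]
  norm_num
  exact CFC.rpow_zero c h0

namespace ImprimitivityBimodule

open scoped RightActions

variable {A B X : Type*} [CStarAlgebra A] [CStarAlgebra B]
    [NormedAddCommGroup X] [NormedSpace ℂ X] [CompleteSpace X] [Module A X] [Module Bᵐᵒᵖ X]
    [IsScalarTower ℂ A X] [IsScalarTower ℂ Bᵐᵒᵖ X] [SMulCommClass A Bᵐᵒᵖ X]
    (E : ImprimitivityBimodule A B X)

theorem inB_add_left (x y z : X) : E.inB (x + y) z = E.inB x z + E.inB y z := by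
  rw [← E.star_inB, E.inB_add_right, star_add, E.star_inB, E.star_inB]

theorem inB_smul_left (b : B) (x y : X) : E.inB (x <• b) y = star b * E.inB x y := by
  rw [← E.star_inB, E.inB_smul_right, star_mul, E.star_inB]

theorem inA_complex_smul (c : ℂ) (x y : X) : E.inA (c • x) y = c • E.inA x y := by
  rw [← one_smul A x, ← smul_assoc, E.inA_smul_left, one_smul, smul_mul_assoc, one_mul]

theorem inB_complex_smul (c : ℂ) (x y : X) : E.inB x (c • y) = c • E.inB x y := by
  rw [← one_smul Bᵐᵒᵖ y, ← smul_assoc, ← MulOpposite.op_one, ← MulOpposite.op_smul,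
    E.inB_smul_right, MulOpposite.op_one, one_smul, mul_smul_comm, mul_one]

/-- In the unital case the `B`-valued inner products of finitely many elements with themselves add
up to the unit. -/
theorem exists_sum_inB_self_eq_one : ∃ (n : ℕ) (x : Fin n → X), ∑ i, E.inB (x i) (x i) = 1 := by
  let _ := CStarAlgebra.spectralOrder B
  have := CStarAlgebra.spectralOrderedRing B
  obtain ⟨r, hr, hr1⟩ := Metric.mem_closure_iff.1 (E.full_inB (1 : B)) 1 one_pos
  have hu : IsUnit r := by
    rw [dist_eq_norm] at hr1
    simpa using isUnit_one_sub_of_norm_lt_one hr1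
  obtain ⟨s, hs⟩ := hu.exists_right_inv
  obtain ⟨n, f, g, hg⟩ := Submodule.mem_span_set'.1 hr
  choose u v huv using fun i => (g i).2
  -- By density some finite sum of inner products is invertible; its inverse and the scalars are
  -- absorbed into the second entries.
  have h1 : ∑ i, E.inB (u i) ((f i • v i) <• s) = 1 := by
    rw [← hs, ← hg, Finset.sum_mul]
    refine Finset.sum_congr rfl fun i _ => ?_
    rw [E.inB_smul_right, E.inB_complex_smul, huv]
  set w := fun i => (f i • v i) <• s
  have h2 : ∑ i, E.inB (w i) (u i) = 1 := by
    rw [← star_one, ← h1, star_sum]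
    exact Finset.sum_congr rfl fun i _ => (E.star_inB _ _).symm
  have hnn : ∀ x, 0 ≤ E.inB x x := fun x => by
    obtain ⟨b, hb⟩ := E.inB_self_nonneg x
    rw [hb]
    exact star_mul_self_nonneg b
  -- Each of the two cross sums equals `1` and the diagonal terms are positive. Conjugating by the
  -- inverse square root of the total then gives exactly `1`.
  have h3 : (1 : B) ≤ ∑ i, E.inB (u i + w i) (u i + w i) := by
    have : ∑ i, E.inB (u i + w i) (u i + w i)
        = 1 + (1 + ∑ i, (E.inB (u i) (u i) + E.inB (w i) (w i))) := by
      nth_rewrite 1 [← h1]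
      rw [← h2, ← Finset.sum_add_distrib, ← Finset.sum_add_distrib]
      refine Finset.sum_congr rfl fun i _ => ?_
      rw [E.inB_add_left, E.inB_add_right, E.inB_add_right]
      abel
    rw [this]
    exact le_add_of_nonneg_right (add_nonneg zero_le_one
      (Finset.sum_nonneg fun i _ => add_nonneg (hnn _) (hnn _)))
  obtain ⟨d, hd⟩ := exists_star_mul_mul_eq_one h3
  refine ⟨n, fun i => (u i + w i) <• d, ?_⟩
  rw [← hd, Finset.mul_sum, Finset.sum_mul]
  exact Finset.sum_congr rfl fun i _ => by rw [E.inB_smul_right, E.inB_smul_left]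

/-- If `B = 0`, the norm formula forces `X = 0`, and fullness over `A` fails. -/
theorem nontrivial_right (E : ImprimitivityBimodule A B X) [Nontrivial A] : Nontrivial B := by
  by_contra hB
  rw [not_nontrivial_iff_subsingleton] at hB
  have hX : ∀ x : X, x = 0 := fun x => by
    have h := E.norm_sq_eq_inB x
    rw [Subsingleton.elim (E.inB x x) 0, norm_zero] at h
    exact norm_eq_zero.1 (pow_eq_zero_iff two_ne_zero |>.1 h)
  have h0 : E.inA 0 0 = 0 := by simpa using E.inA_complex_smul 0 0 0
  have hset : {a : A | ∃ x y, a = E.inA x y} ⊆ {0} := by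
    rintro _ ⟨x, y, rfl⟩
    rw [hX x, hX y, h0]
    rfl
  have hspan := Submodule.span_mono (R := ℂ) hset
  rw [Submodule.span_zero_singleton, le_bot_iff] at hspan
  have hd := E.full_inA
  rw [hspan] at hd
  have h1 : (1 : A) ∈ closure ((⊥ : Submodule ℂ A) : Set A) := hd 1
  rw [Submodule.bot_coe, closure_singleton] at h1
  exact one_ne_zero h1

/-- The functional `b ↦ ∑ τ ⟨xᵢ b, xᵢ⟩` induced by a functional `τ` on `A`. -/
noncomputable def inducedFunctional (τ : A →L[ℂ] ℂ) {n : ℕ} (x : Fin n → X) : B →ₗ[ℂ] ℂ where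
  toFun b := ∑ i, τ (E.inA (x i <• b) (x i))
  map_add' b c := by
    rw [← Finset.sum_add_distrib]
    refine Finset.sum_congr rfl fun i _ => ?_
    rw [MulOpposite.op_add, add_smul, E.inA_add_left, map_add]
  map_smul' c b := by
    rw [RingHom.id_apply, Finset.smul_sum]
    refine Finset.sum_congr rfl fun i _ => ?_
    rw [MulOpposite.op_smul, smul_assoc, E.inA_complex_smul, map_smul]

/-- Since `xᵢ ⟨y, z⟩_B = ⟨xᵢ, y⟩_A z`, each term is `τ (⟨xᵢ, y⟩ ⟨z, xᵢ⟩)`. Commuting the factors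
gives `τ ⟨z ⟨xᵢ, xᵢ⟩_B, y⟩_A`, and the `⟨xᵢ, xᵢ⟩_B` sum to `1`. -/
theorem inducedFunctional_inB {τ : A →L[ℂ] ℂ} (hτ : IsBoundedTrace τ) {n : ℕ} {x : Fin n → X}
    (hx : ∑ i, E.inB (x i) (x i) = 1) (y z : X) :
    E.inducedFunctional τ x (E.inB y z) = τ (E.inA z y) := by
  have h1 : ∀ i, τ (E.inA (x i <• E.inB y z) (x i)) = τ (E.inA (z <• E.inB (x i) (x i)) y) := by
    intro i
    rw [← E.inA_smul_eq_smul_inB, ← E.inA_smul_eq_smul_inB, E.inA_smul_left, E.inA_smul_left,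
      hτ.mul_comm]
  change ∑ i, τ (E.inA (x i <• E.inB y z) (x i)) = _
  let φ : X →+ ℂ := AddMonoidHom.mk' (fun w => τ (E.inA w y)) fun v w => by
    rw [E.inA_add_left, map_add]
  rw [Finset.sum_congr rfl fun i _ => h1 i]
  have hop : MulOpposite.op (∑ i, E.inB (x i) (x i)) = ∑ i, MulOpposite.op (E.inB (x i) (x i)) :=
    map_sum (MulOpposite.opAddEquiv (α := B)) _ _
  change ∑ i, φ (z <• E.inB (x i) (x i)) = φ z
  rw [← map_sum, ← Finset.sum_smul, ← hop, hx, MulOpposite.op_one, one_smul]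

theorem hasFaithfulTrace (E : ImprimitivityBimodule A B X) (h : HasFaithfulTrace A) : HasFaithfulTrace B := by
  let _ := CStarAlgebra.spectralOrder B
  have := CStarAlgebra.spectralOrderedRing B
  have := h.nontrivial
  have := E.nontrivial_right
  obtain ⟨τ, hτ', hf⟩ := h
  have hτ := hτ'.toIsBoundedTrace
  obtain ⟨n, x, hx⟩ := E.exists_sum_inB_self_eq_one
  set ω := E.inducedFunctional τ x with hω
  have hval : ∀ b, ω (star b * b) = ∑ i, τ (E.inA (x i <• star b) (x i <• star b)) := fun b => by
    change ∑ i, τ (E.inA (x i <• (star b * b)) (x i)) = _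
    refine Finset.sum_congr rfl fun i _ => ?_
    rw [MulOpposite.op_mul, mul_smul, E.inA_adjoint]
  have hterm : ∀ y, ∃ r : ℝ, 0 ≤ r ∧ τ (E.inA y y) = r := fun y => by
    obtain ⟨a, ha⟩ := E.inA_self_nonneg y
    rw [ha]
    exact hτ.nonneg_star_mul_self a
  choose r hr0 hr using hterm
  have hpos : ∀ b, ω (star b * b) = ((∑ i, r (x i <• star b) : ℝ) : ℂ) := fun b => by
    rw [hval, Complex.ofReal_sum]
    exact Finset.sum_congr rfl fun i _ => hr _
  have hcomm : ∀ b c, ω (b * c) = ω (c * b) := fun b c => by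
    -- Both products are written as sums of inner products, so that the formula for `ω` on these
    -- reduces commutation to moving `c` across `inA`.
    have h1 : b * c = ∑ i, E.inB (x i) (x i <• (b * c)) := by
      simp_rw [E.inB_smul_right, ← Finset.sum_mul, hx, one_mul]
    have h2 : c * b = ∑ i, E.inB (x i <• star c) (x i <• b) := by
      simp_rw [E.inB_smul_right, E.inB_smul_left, star_star, ← Finset.sum_mul, ← Finset.mul_sum,
        hx, mul_one]
    rw [h1, h2, map_sum, map_sum]
    refine Finset.sum_congr rfl fun i _ => ?_
    rw [E.inducedFunctional_inB hτ hx, E.inducedFunctional_inB hτ hx, ← E.inA_adjoint,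
      MulOpposite.op_mul, mul_smul]
  -- Positive functionals on a C⋆-algebra are automatically bounded.
  have hbound : ∃ C : ℝ, ∀ b, ‖ω b‖ ≤ C * ‖b‖ := by
    open ComplexOrder in
    obtain ⟨C, hC⟩ := (PositiveLinearMap.mk₀ ω fun b hb => by
      obtain ⟨c, rfl⟩ := CStarAlgebra.nonneg_iff_eq_star_mul_self.1 hb
      rw [hpos]
      exact Complex.zero_le_real.2 (Finset.sum_nonneg fun i _ => hr0 _)).exists_norm_apply_le
    exact ⟨C, hC⟩
  obtain ⟨C, hC⟩ := hbound
  refine HasFaithfulBoundedTrace.normalize ⟨ω.mkContinuous C hC, isBoundedTrace_of_mul_comm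
    (fun b => ⟨_, Finset.sum_nonneg fun i _ => hr0 _, hpos b⟩) hcomm, fun b hb => ?_⟩
  have hb' : ((∑ i, r (x i <• star b) : ℝ) : ℂ) = 0 := (hpos b).symm.trans hb
  rw [Complex.ofReal_eq_zero, Finset.sum_eq_zero_iff_of_nonneg fun i _ => hr0 _] at hb'
  have h0 : ∀ i, x i <• star b = 0 := fun i => by
    have h1 : τ (E.inA (x i <• star b) (x i <• star b)) = 0 := by
      rw [hr, hb' i (Finset.mem_univ i), Complex.ofReal_zero]
    obtain ⟨a, ha⟩ := E.inA_self_nonneg (x i <• star b)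
    have h2 := E.norm_sq_eq_inA (x i <• star b)
    rw [ha] at h1 h2
    rw [hf a h1, mul_zero, norm_zero] at h2
    exact norm_eq_zero.1 (pow_eq_zero_iff two_ne_zero |>.1 h2)
  -- Here `b* = ∑ ⟨xᵢ, xᵢ b*⟩_B`, and every `xᵢ b*` vanishes.
  rw [← star_eq_zero, ← one_mul (star b), ← hx, Finset.sum_mul]
  refine Finset.sum_eq_zero fun i _ => ?_
  rw [← E.inB_smul_right, h0, ← zero_smul ℂ (0 : X), E.inB_complex_smul, zero_smul]

end ImprimitivityBimodule

/-! ### Minimal tensor products and slice maps -/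

/-- An injective unital ⋆-homomorphism reflects positivity. -/
theorem exists_eq_star_mul_self_of_map {A D : Type*} [CStarAlgebra A] [CStarAlgebra D]
    [PartialOrder D] [StarOrderedRing D] (π : A →⋆ₐ[ℂ] D) (hπ : Function.Injective π) {a : A}
    (ha : 0 ≤ π a) : ∃ c, a = star c * c := by
  let _ := CStarAlgebra.spectralOrder A
  have := CStarAlgebra.spectralOrderedRing A
  have hsa : IsSelfAdjoint a := hπ (by rw [map_star, (IsSelfAdjoint.of_nonneg ha).star_eq])
  refine CStarAlgebra.nonneg_iff_eq_star_mul_self.1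
    ((StarOrderedRing.nonneg_iff_spectrum_nonneg (R := ℝ) a).2 fun t ht => ?_)
  rw [← hsa.map_spectrum_real π hπ] at ht
  exact spectrum_nonneg_of_nonneg ha ht

section MinTensor

variable {A B H K : Type*} [CStarAlgebra A] [CStarAlgebra B]
  [NormedAddCommGroup H] [InnerProductSpace ℂ H]
  [NormedAddCommGroup K] [InnerProductSpace ℂ K]

theorem HilbertTensor.inner_tmul (x x' : H) (y y' : K) :
    inner ℂ (HilbertTensor.tmul x y) (HilbertTensor.tmul x' y') =
      inner ℂ x x' * inner ℂ y y' :=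
  (UniformSpace.Completion.inner_coe _ _).trans (TensorProduct.inner_tmul ..)

theorem HilbertTensor.norm_tmul (x : H) (y : K) : ‖HilbertTensor.tmul x y‖ = ‖x‖ * ‖y‖ :=
  (UniformSpace.Completion.norm_coe _).trans (TensorProduct.norm_tmul x y)

/-- Operators on the tensor product are determined by their values on elementary tensors. -/
theorem HilbertTensor.clm_ext {F : Type*} [NormedAddCommGroup F] [NormedSpace ℂ F]
    {S T : HilbertTensor H K →L[ℂ] F}
    (h : ∀ x y, S (HilbertTensor.tmul x y) = T (HilbertTensor.tmul x y)) : S = T := by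
  refine ContinuousLinearMap.ext fun z => ?_
  refine UniformSpace.Completion.induction_on (α := H ⊗[ℂ] K) z
    (isClosed_eq S.continuous T.continuous) fun w => ?_
  induction w using TensorProduct.induction_on with
  | zero => exact (map_zero S).trans (map_zero T).symm
  | tmul x y => exact h x y
  | add v w hv hw =>
    rw [UniformSpace.Completion.coe_add]
    exact (map_add S _ _).trans ((congrArg₂ _ hv hw).trans (map_add T _ _).symm)

/-- The operators `y ↦ x ⊗ y`. -/
noncomputable def tensorLeft (H K : Type*) [NormedAddCommGroup H] [InnerProductSpace ℂ H]
    [NormedAddCommGroup K] [InnerProductSpace ℂ K] : H →L[ℂ] K →L[ℂ] HilbertTensor H K :=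
  ContinuousLinearMap.compL ℂ K (H ⊗[ℂ] K) (HilbertTensor H K)
    (UniformSpace.Completion.toComplL (𝕜 := ℂ) (E := H ⊗[ℂ] K)) ∘L TensorProduct.mkL ℂ H K

theorem tensorLeft_apply (x : H) (y : K) : tensorLeft H K x y = HilbertTensor.tmul x y := rfl

theorem opTensor_mul (S S' : H →L[ℂ] H) (T T' : K →L[ℂ] K) :
    opTensor (S * S') (T * T') = opTensor S T * opTensor S' T' :=
  HilbertTensor.clm_ext fun x y => by
    rw [mul_apply_eq_comp, opTensor_tmul, opTensor_tmul, opTensor_tmul]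
    rfl

theorem opTensor_one : opTensor (1 : H →L[ℂ] H) (1 : K →L[ℂ] K) = 1 :=
  HilbertTensor.clm_ext fun x y => by rw [opTensor_tmul]; rfl

variable [CompleteSpace K]

/-- The slice map `T ↦ (x' ⊗ ·)* T (x ⊗ ·)`. -/
noncomputable def slice (x' x : H) :
    (HilbertTensor H K →L[ℂ] HilbertTensor H K) →L[ℂ] K →L[ℂ] K :=
  ContinuousLinearMap.compL ℂ K (HilbertTensor H K) K (tensorLeft H K x').adjoint ∘L
    (ContinuousLinearMap.compL ℂ K (HilbertTensor H K) (HilbertTensor H K)).flip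
      (tensorLeft H K x)

theorem slice_apply (x' x : H) (T : HilbertTensor H K →L[ℂ] HilbertTensor H K) :
    slice x' x T = (tensorLeft H K x').adjoint ∘L (T ∘L tensorLeft H K x) := rfl

theorem inner_slice (x' x : H) (T : HilbertTensor H K →L[ℂ] HilbertTensor H K) (y' y : K) :
    inner ℂ y' (slice x' x T y) =
      inner ℂ (HilbertTensor.tmul x' y') (T (HilbertTensor.tmul x y)) := by
  rw [slice_apply, ContinuousLinearMap.comp_apply, ContinuousLinearMap.adjoint_inner_right]
  rfl

theorem norm_slice_le (x' x : H) (T : HilbertTensor H K →L[ℂ] HilbertTensor H K) :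
    ‖slice x' x T‖ ≤ ‖x'‖ * ‖T‖ * ‖x‖ := by
  have h : ∀ x : H, ‖tensorLeft H K x‖ ≤ ‖x‖ := fun x =>
    ContinuousLinearMap.opNorm_le_bound _ (norm_nonneg _) fun y =>
      (HilbertTensor.norm_tmul x y).le
  rw [slice_apply, mul_assoc]
  refine (ContinuousLinearMap.opNorm_comp_le _ _).trans (mul_le_mul ?_
    ((ContinuousLinearMap.opNorm_comp_le _ _).trans ?_) (norm_nonneg _) (norm_nonneg _))
  · rw [LinearIsometryEquiv.norm_map]
    exact h x'
  · gcongr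
    exact h x

theorem slice_opTensor (x' x : H) (P : H →L[ℂ] H) (Q : K →L[ℂ] K) :
    slice x' x (opTensor P Q) = inner ℂ x' (P x) • Q := by
  refine ContinuousLinearMap.ext fun y => ext_inner_left ℂ fun y' => ?_
  rw [inner_slice, opTensor_tmul, HilbertTensor.inner_tmul, smul_apply, inner_smul_right]

/-- Operators on the tensor product are determined by their slices. -/
theorem ext_slice {S T : HilbertTensor H K →L[ℂ] HilbertTensor H K}
    (h : ∀ x' x, slice x' x S = slice x' x T) : S = T := by
  refine HilbertTensor.clm_ext fun x y => ext_inner_left ℂ fun z => ?_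
  rw [← InnerProductSpace.conj_inner_symm, ← InnerProductSpace.conj_inner_symm _ (T _)]
  congr 1
  refine DFunLike.congr_fun (HilbertTensor.clm_ext (H := H) (K := K)
    (S := innerSL ℂ (S (HilbertTensor.tmul x y)))
    (T := innerSL ℂ (T (HilbertTensor.tmul x y))) fun x' y' => ?_) z
  rw [innerSL_apply_apply, innerSL_apply_apply, ← InnerProductSpace.conj_inner_symm,
    ← InnerProductSpace.conj_inner_symm (T _), ← inner_slice, ← inner_slice, h]

theorem slice_star_mul_self_nonneg (T : HilbertTensor H K →L[ℂ] HilbertTensor H K) (x : H) :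
    0 ≤ slice x x (star T * T) := by
  have : slice x x (star T * T) = (T ∘L tensorLeft H K x).adjoint ∘L (T ∘L tensorLeft H K x) := by
    rw [slice_apply, ContinuousLinearMap.adjoint_comp]
    rfl
  rw [this, ContinuousLinearMap.nonneg_iff_isPositive]
  exact ContinuousLinearMap.isPositive_adjoint_comp_self _

variable [CompleteSpace H]

theorem star_opTensor (P : H →L[ℂ] H) (Q : K →L[ℂ] K) :
    star (opTensor P Q) = opTensor (star P) (star Q) := by
  refine ext_slice fun x' x => ContinuousLinearMap.ext fun y => ext_inner_left ℂ fun y' => ?_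
  rw [inner_slice, inner_slice, opTensor_tmul, HilbertTensor.inner_tmul,
    ContinuousLinearMap.star_eq_adjoint, ContinuousLinearMap.star_eq_adjoint,
    ContinuousLinearMap.star_eq_adjoint, ContinuousLinearMap.adjoint_inner_right, opTensor_tmul,
    HilbertTensor.inner_tmul, ContinuousLinearMap.adjoint_inner_right,
    ContinuousLinearMap.adjoint_inner_right]

/-- The sesquilinear form `(x', x) ↦ ψ (slice x' x T)`. -/
noncomputable def sliceForm (ψ : (K →L[ℂ] K) →L[ℂ] ℂ)
    (T : HilbertTensor H K →L[ℂ] HilbertTensor H K) : H →L⋆[ℂ] H →L[ℂ] ℂ :=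
  LinearMap.mkContinuous₂
    (LinearMap.mk₂'ₛₗ (starRingEnd ℂ) (RingHom.id ℂ) (fun x' x => ψ (slice x' x T))
      (fun a b x => by
        rw [slice_apply, map_add, map_add, ContinuousLinearMap.add_comp, map_add]; rfl)
      (fun c a x => by
        rw [slice_apply, map_smul, map_smulₛₗ, ContinuousLinearMap.smul_comp, map_smul]; rfl)
      (fun a x y => by
        rw [slice_apply, map_add, ContinuousLinearMap.comp_add, ContinuousLinearMap.comp_add,
          map_add]; rfl)
      (fun c a x => by
        rw [slice_apply, map_smul, ContinuousLinearMap.comp_smul, ContinuousLinearMap.comp_smul,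
          map_smul]; rfl))
    (‖ψ‖ * ‖T‖) fun x' x => by
      refine (ψ.le_opNorm _).trans ?_
      refine (mul_le_mul_of_nonneg_left (norm_slice_le x' x T) (norm_nonneg _)).trans_eq ?_
      ring

/-- The slice map with respect to a functional on the operators on the second factor. -/
noncomputable def rightSlice (ψ : (K →L[ℂ] K) →L[ℂ] ℂ)
    (T : HilbertTensor H K →L[ℂ] HilbertTensor H K) : H →L[ℂ] H :=
  (InnerProductSpace.continuousLinearMapOfBilin (sliceForm ψ T)).adjoint

theorem inner_rightSlice (ψ : (K →L[ℂ] K) →L[ℂ] ℂ)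
    (T : HilbertTensor H K →L[ℂ] HilbertTensor H K) (x' x : H) :
    inner ℂ x' (rightSlice ψ T x) = ψ (slice x' x T) := by
  rw [rightSlice, ContinuousLinearMap.adjoint_inner_right,
    InnerProductSpace.continuousLinearMapOfBilin_apply]
  rfl

/-- `rightSlice` as a bounded linear map. -/
noncomputable def rightSliceL (ψ : (K →L[ℂ] K) →L[ℂ] ℂ) :
    (HilbertTensor H K →L[ℂ] HilbertTensor H K) →L[ℂ] H →L[ℂ] H :=
  LinearMap.mkContinuous
    { toFun := rightSlice ψ
      map_add' := fun S T => ContinuousLinearMap.ext fun x => ext_inner_left ℂ fun x' => by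
        rw [add_apply, inner_add_right, inner_rightSlice, inner_rightSlice, inner_rightSlice,
          map_add, map_add]
      map_smul' := fun c T => ContinuousLinearMap.ext fun x => ext_inner_left ℂ fun x' => by
        rw [smul_apply, inner_smul_right, inner_rightSlice, inner_rightSlice, map_smul, map_smul]
        rfl }
    ‖ψ‖ fun T => by
      refine ContinuousLinearMap.opNorm_le_bound _ (by positivity) fun x => ?_
      change ‖rightSlice ψ T x‖ ≤ _
      -- Pair the vector with itself and cancel one factor of its norm.
      have h : ‖rightSlice ψ T x‖ * ‖rightSlice ψ T x‖
          ≤ ‖rightSlice ψ T x‖ * (‖ψ‖ * ‖T‖ * ‖x‖) := by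
        rw [← inner_self_eq_norm_mul_norm (𝕜 := ℂ), inner_rightSlice]
        refine (Complex.re_le_norm _).trans ((ψ.le_opNorm _).trans ?_)
        refine (mul_le_mul_of_nonneg_left (norm_slice_le _ x T) (norm_nonneg _)).trans_eq ?_
        ring
      rcases (norm_nonneg (rightSlice ψ T x)).eq_or_lt with h0 | h0
      · rw [← h0]
        positivity
      · exact le_of_mul_le_mul_left h h0

theorem inner_rightSliceL (ψ : (K →L[ℂ] K) →L[ℂ] ℂ)
    (T : HilbertTensor H K →L[ℂ] HilbertTensor H K) (x' x : H) :
    inner ℂ x' (rightSliceL ψ T x) = ψ (slice x' x T) :=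
  inner_rightSlice ψ T x' x

theorem rightSliceL_opTensor (ψ : (K →L[ℂ] K) →L[ℂ] ℂ) (P : H →L[ℂ] H) (Q : K →L[ℂ] K) :
    rightSliceL ψ (opTensor P Q) = ψ Q • P := by
  refine ContinuousLinearMap.ext fun x => ext_inner_left ℂ fun x' => ?_
  rw [inner_rightSliceL, slice_opTensor, map_smul, smul_apply, inner_smul_right, smul_eq_mul,
    mul_comm]

variable {π : A →⋆ₐ[ℂ] (H →L[ℂ] H)} {σ : B →⋆ₐ[ℂ] (K →L[ℂ] K)}

theorem opTensor_mem_minTensor (a : A) (b : B) : opTensor (π a) (σ b) ∈ minTensor π σ :=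
  StarSubalgebra.le_topologicalClosure _ (StarAlgebra.subset_adjoin ℂ _ ⟨a, b, rfl⟩)

/-- The elementary tensors span a dense subspace of the minimal tensor product. -/
theorem mem_of_mem_minTensor {p : Submodule ℂ (HilbertTensor H K →L[ℂ] HilbertTensor H K)}
    (hp : IsClosed (p : Set (HilbertTensor H K →L[ℂ] HilbertTensor H K)))
    (h : ∀ a b, opTensor (π a) (σ b) ∈ p) {T : HilbertTensor H K →L[ℂ] HilbertTensor H K}
    (hT : T ∈ minTensor π σ) : T ∈ p := by
  refine closure_minimal (fun S hS => ?_) hp hT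
  -- The elementary tensors are closed under products and adjoints, so the ⋆-algebra they generate
  -- is just their linear span.
  let E : Submonoid (HilbertTensor H K →L[ℂ] HilbertTensor H K) :=
    { carrier := {T | ∃ (a : A) (b : B), T = opTensor (π a) (σ b)}
      one_mem' := ⟨1, 1, by rw [map_one, map_one, opTensor_one]⟩
      mul_mem' := by
        rintro _ _ ⟨a, b, rfl⟩ ⟨c, d, rfl⟩
        exact ⟨a * c, b * d, by rw [map_mul, map_mul, opTensor_mul]⟩ }
  have h1 : S ∈ Submodule.span ℂ (↑(Submonoid.closure ((E : Set (HilbertTensor H K →L[ℂ]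
      HilbertTensor H K)) ∪ star ↑E)) : Set (HilbertTensor H K →L[ℂ] HilbertTensor H K)) := by
    rw [← StarAlgebra.adjoin_eq_span]
    exact hS
  have h2 : Submonoid.closure ((E : Set (HilbertTensor H K →L[ℂ] HilbertTensor H K)) ∪ star ↑E) ≤ E := by
    refine Submonoid.closure_le.2 (Set.union_subset le_rfl ?_)
    rintro T ⟨a, b, hab⟩
    exact ⟨star a, star b, by rw [map_star, map_star, ← star_opTensor, ← hab, star_star]⟩
  refine Submodule.span_le.2 (fun R hR => ?_) h1
  obtain ⟨a, b, rfl⟩ := h2 hR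
  exact h a b

end MinTensor

theorem isClosed_range_of_injective {A D : Type*} [CStarAlgebra A] [CStarAlgebra D]
    (π : A →⋆ₐ[ℂ] D) (hπ : Function.Injective π) :
    IsClosed (LinearMap.range π.toAlgHom.toLinearMap : Set D) :=
  (NonUnitalStarAlgHom.isometry π hπ).isClosedEmbedding.isClosed_range

section MinTensor

variable {A B H K : Type*} [CStarAlgebra A] [CStarAlgebra B]
  [NormedAddCommGroup H] [InnerProductSpace ℂ H] [CompleteSpace H]
  [NormedAddCommGroup K] [InnerProductSpace ℂ K] [CompleteSpace K]
  {π : A →⋆ₐ[ℂ] (H →L[ℂ] H)} {σ : B →⋆ₐ[ℂ] (K →L[ℂ] K)}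

/-- Slicing is continuous and sends `π a ⊗ σ b` to a multiple of `σ b`; the image of `σ` is closed
because injective ⋆-homomorphisms are isometric. -/
theorem exists_slice_eq (hσ : Function.Injective σ) (x' x : H)
    {T : HilbertTensor H K →L[ℂ] HilbertTensor H K} (hT : T ∈ minTensor π σ) :
    ∃ b, σ b = slice x' x T := by
  have hp := (isClosed_range_of_injective σ hσ).preimage (slice (K := K) x' x).continuous
  refine mem_of_mem_minTensor (p := (LinearMap.range σ.toAlgHom.toLinearMap).comap
    (slice x' x).toLinearMap) hp (fun a b => ⟨inner ℂ x' (π a x) • b, ?_⟩) hT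
  exact (map_smul σ _ _).trans (slice_opTensor _ _ _ _).symm

theorem exists_rightSlice_eq (hπ : Function.Injective π) (ψ : (K →L[ℂ] K) →L[ℂ] ℂ)
    {T : HilbertTensor H K →L[ℂ] HilbertTensor H K} (hT : T ∈ minTensor π σ) :
    ∃ a, π a = rightSliceL ψ T := by
  have hp := (isClosed_range_of_injective π hπ).preimage (rightSliceL (H := H) ψ).continuous
  refine mem_of_mem_minTensor (p := (LinearMap.range π.toAlgHom.toLinearMap).comap
    (rightSliceL ψ).toLinearMap) hp (fun a b => ⟨ψ (σ b) • a, ?_⟩) hT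
  exact (map_smul π _ _).trans (rightSliceL_opTensor _ _ _).symm

/-- A functional on operators that restricts to a trace on the elementary tensors is a trace. -/
theorem apply_mul_comm_of_mem_minTensor
    {ω : (HilbertTensor H K →L[ℂ] HilbertTensor H K) →L[ℂ] ℂ}
    (h : ∀ a b c d, ω (opTensor (π a) (σ b) * opTensor (π c) (σ d)) =
      ω (opTensor (π c) (σ d) * opTensor (π a) (σ b)))
    {S T : HilbertTensor H K →L[ℂ] HilbertTensor H K}
    (hS : S ∈ minTensor π σ) (hT : T ∈ minTensor π σ) : ω (S * T) = ω (T * S) := by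
  let M := ContinuousLinearMap.mul ℂ (HilbertTensor H K →L[ℂ] HilbertTensor H K)
  -- Density in one variable; used first with `R` an elementary tensor, then with `R = S`.
  have key : ∀ R : HilbertTensor H K →L[ℂ] HilbertTensor H K,
      (∀ a b, ω (R * opTensor (π a) (σ b)) = ω (opTensor (π a) (σ b) * R)) →
      ∀ T ∈ minTensor π σ, ω (R * T) = ω (T * R) := by
    intro R hR T hT
    have hp : T ∈ LinearMap.ker (ω ∘L M R - ω ∘L M.flip R).toLinearMap :=
      mem_of_mem_minTensor (p := LinearMap.ker (ω ∘L M R - ω ∘L M.flip R).toLinearMap) (ContinuousLinearMap.isClosed_ker _)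
        (fun a b => sub_eq_zero.2 (hR a b)) hT
    exact sub_eq_zero.1 hp
  exact key S (fun a b => (key _ (fun c d => h a b c d) S hS).symm) T hT

/-- The tensor product of faithful traces. -/
theorem hasFaithfulTrace_minTensor (hπ : Function.Injective π) (hσ : Function.Injective σ)
    (hA : HasFaithfulTrace A) (hB : HasFaithfulTrace B) :
    HasFaithfulTrace (minTensor π σ) := by
  have := hA.nontrivial
  have := hB.nontrivial
  have hnt : Nontrivial (minTensor π σ) := by
    have h1 : (1 : H →L[ℂ] H) ≠ 0 := by
      rw [← map_one π, ← map_zero π]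
      exact hπ.ne one_ne_zero
    have h2 : (1 : K →L[ℂ] K) ≠ 0 := by
      rw [← map_one σ, ← map_zero σ]
      exact hσ.ne one_ne_zero
    obtain ⟨x, hx⟩ := DFunLike.ne_iff.1 h1
    obtain ⟨y, hy⟩ := DFunLike.ne_iff.1 h2
    refine ⟨1, 0, fun h => ?_⟩
    have h3 : (1 : HilbertTensor H K →L[ℂ] HilbertTensor H K) = 0 := congrArg Subtype.val h
    have h4 : HilbertTensor.tmul x y = 0 := DFunLike.congr_fun h3 _
    have h5 := HilbertTensor.norm_tmul x y
    rw [h4, norm_zero] at h5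
    rcases mul_eq_zero.1 h5.symm with h | h
    · exact hx (norm_eq_zero.1 h)
    · exact hy (norm_eq_zero.1 h)
  obtain ⟨τA, hτA, hfA⟩ := hA
  obtain ⟨τB, hτB, hfB⟩ := hB
  -- The extensions `φ` and `ψ` need not be positive or tracial. This is harmless, since they are
  -- evaluated only on the images of `A` and `B`.
  obtain ⟨φ, hφ⟩ := exists_extension_of_injective (π : A →⋆ₙₐ[ℂ] (H →L[ℂ] H)) hπ τA
  obtain ⟨ψ, hψ⟩ := exists_extension_of_injective (σ : B →⋆ₙₐ[ℂ] (K →L[ℂ] K)) hσ τB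
  have hφ : ∀ a, φ (π a) = τA a := hφ
  have hψ : ∀ b, ψ (σ b) = τB b := hψ
  have hslice : ∀ (T : minTensor π σ) (x : H),
      ∃ b, σ (star b * b) = slice x x (star T.1 * T.1) := by
    intro T x
    obtain ⟨b, hb⟩ := exists_slice_eq hσ x x (star T * T).2
    have h0 : 0 ≤ σ b := by rw [hb]; exact slice_star_mul_self_nonneg _ _
    obtain ⟨c, rfl⟩ := exists_eq_star_mul_self_of_map σ hσ h0
    exact ⟨c, hb⟩
  have hright : ∀ T : minTensor π σ, ∃ a, π (star a * a) =
      rightSliceL ψ (star T.1 * T.1) := by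
    intro T
    obtain ⟨a, ha⟩ := exists_rightSlice_eq hπ ψ (star T * T).2
    -- Its diagonal matrix coefficients are values of `τB` at positive elements, namely at the
    -- slices of `T* T`.
    have h0 : 0 ≤ π a := by
      rw [ha, ContinuousLinearMap.nonneg_iff_isPositive,
        ContinuousLinearMap.isPositive_iff_complex]
      intro x
      obtain ⟨b, hb⟩ := hslice T x
      obtain ⟨r, hr0, hr⟩ := hτB.nonneg_star_mul_self b
      have h1 : inner ℂ (rightSliceL ψ ((star T * T : minTensor π σ) :
          HilbertTensor H K →L[ℂ] HilbertTensor H K) x) x = (r : ℂ) := by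
        rw [← InnerProductSpace.conj_inner_symm, inner_rightSliceL]
        change (starRingEnd ℂ) (ψ (slice x x (star T.1 * T.1))) = _
        rw [← hb, hψ, hr, Complex.conj_ofReal]
      rw [h1]
      simpa using hr0
    obtain ⟨c, rfl⟩ := exists_eq_star_mul_self_of_map π hπ h0
    exact ⟨c, ha⟩
  let ω := φ ∘L rightSliceL (H := H) ψ
  let ω' : minTensor π σ →L[ℂ] ℂ := ω ∘L (minTensor π σ).toSubalgebra.toSubmodule.subtypeL
  have hω : ∀ T : minTensor π σ, ∃ a, ω' (star T * T) = τA (star a * a) ∧ π (star a * a) =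
      rightSliceL ψ (star T.1 * T.1) := fun T => by
    obtain ⟨a, ha⟩ := hright T
    exact ⟨a, by rw [← hφ, ha]; rfl, ha⟩
  have htr : ∀ a b c d, ω (opTensor (π a) (σ b) * opTensor (π c) (σ d)) =
      ω (opTensor (π c) (σ d) * opTensor (π a) (σ b)) := by
    have h : ∀ a b c d, ω (opTensor (π a) (σ b) * opTensor (π c) (σ d)) =
        τB (b * d) * τA (a * c) := fun a b c d => by
      rw [← opTensor_mul, ← map_mul, ← map_mul, ← hψ, ← hφ]
      change φ (rightSliceL ψ _) = _
      rw [rightSliceL_opTensor, map_smul, smul_eq_mul]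
    intro a b c d
    rw [h, h, hτA.mul_comm, hτB.mul_comm]
  refine HasFaithfulBoundedTrace.normalize ⟨ω', isBoundedTrace_of_mul_comm (fun T => ?_)
    fun S T => apply_mul_comm_of_mem_minTensor htr S.2 T.2, fun T hT => ?_⟩
  · obtain ⟨a, ha, -⟩ := hω T
    rw [ha]
    exact hτA.nonneg_star_mul_self a
  -- Faithfulness of `τA` kills the right slice of `T* T`, and that of `τB` then kills every
  -- diagonal slice, whence `‖T (x ⊗ y)‖² = 0`.
  · obtain ⟨a, ha, haS⟩ := hω T
    rw [hT] at ha
    rw [hfA a ha.symm, mul_zero, map_zero] at haS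
    refine Subtype.ext (HilbertTensor.clm_ext fun x y => ?_)
    obtain ⟨b, hb⟩ := hslice T x
    have h1 : τB (star b * b) = 0 := by
      rw [← hψ, hb, ← inner_rightSliceL, ← haS]
      exact inner_zero_right x
    rw [hfB b h1, mul_zero, map_zero] at hb
    have h2 : inner ℂ (T.1 (HilbertTensor.tmul x y))
        (T.1 (HilbertTensor.tmul x y)) = 0 := by
      have h3 := inner_slice x x (star T.1 * T.1) y y
      rw [← hb, ContinuousLinearMap.star_eq_adjoint, mul_apply_eq_comp,
        ContinuousLinearMap.adjoint_inner_right] at h3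
      rw [← h3]
      exact inner_zero_right y
    exact inner_self_eq_zero.1 h2

/-- The embedding `a ↦ a ⊗ 1` into the minimal tensor product. -/
noncomputable def inclLeft (π : A →⋆ₐ[ℂ] (H →L[ℂ] H)) (σ : B →⋆ₐ[ℂ] (K →L[ℂ] K)) :
    A →⋆ₙₐ[ℂ] minTensor π σ where
  toFun a := ⟨opTensor (π a) (σ 1), opTensor_mem_minTensor a 1⟩
  map_smul' c a := Subtype.ext <| HilbertTensor.clm_ext fun x y => by
    change opTensor (π (c • a)) (σ 1) _ = c • opTensor (π a) (σ 1) _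
    rw [opTensor_tmul, opTensor_tmul, ← tensorLeft_apply, ← tensorLeft_apply, map_smul, smul_apply,
      map_smul, smul_apply]
  map_zero' := Subtype.ext <| HilbertTensor.clm_ext fun x y => by
    change opTensor (π 0) (σ 1) _ = 0
    rw [opTensor_tmul, ← tensorLeft_apply, map_zero, zero_apply, map_zero, zero_apply]
  map_add' a a' := Subtype.ext <| HilbertTensor.clm_ext fun x y => by
    change opTensor (π (a + a')) (σ 1) _ = opTensor (π a) (σ 1) _ + opTensor (π a') (σ 1) _
    rw [opTensor_tmul, opTensor_tmul, opTensor_tmul, ← tensorLeft_apply, ← tensorLeft_apply,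
      ← tensorLeft_apply, map_add, add_apply, map_add, add_apply]
  map_mul' a a' := Subtype.ext <| by
    change opTensor (π (a * a')) (σ 1) = opTensor (π a) (σ 1) * opTensor (π a') (σ 1)
    rw [← opTensor_mul, ← map_mul, ← map_mul, mul_one]
  map_star' a := Subtype.ext <| by
    change opTensor (π (star a)) (σ 1) = star (opTensor (π a) (σ 1))
    rw [star_opTensor, ← map_star, ← map_star, star_one]

/-- The embedding `b ↦ 1 ⊗ b` into the minimal tensor product. -/
noncomputable def inclRight (π : A →⋆ₐ[ℂ] (H →L[ℂ] H)) (σ : B →⋆ₐ[ℂ] (K →L[ℂ] K)) :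
    B →⋆ₙₐ[ℂ] minTensor π σ where
  toFun b := ⟨opTensor (π 1) (σ b), opTensor_mem_minTensor 1 b⟩
  map_smul' c b := Subtype.ext <| HilbertTensor.clm_ext fun x y => by
    change opTensor (π 1) (σ (c • b)) _ = c • opTensor (π 1) (σ b) _
    rw [opTensor_tmul, opTensor_tmul, ← tensorLeft_apply, ← tensorLeft_apply, map_smul, smul_apply,
      map_smul]
  map_zero' := Subtype.ext <| HilbertTensor.clm_ext fun x y => by
    change opTensor (π 1) (σ 0) _ = 0
    rw [opTensor_tmul, ← tensorLeft_apply, map_zero, zero_apply, map_zero]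
  map_add' b b' := Subtype.ext <| HilbertTensor.clm_ext fun x y => by
    change opTensor (π 1) (σ (b + b')) _ = opTensor (π 1) (σ b) _ + opTensor (π 1) (σ b') _
    rw [opTensor_tmul, opTensor_tmul, opTensor_tmul, ← tensorLeft_apply, ← tensorLeft_apply,
      ← tensorLeft_apply, map_add σ, add_apply, map_add]
  map_mul' b b' := Subtype.ext <| by
    change opTensor (π 1) (σ (b * b')) = opTensor (π 1) (σ b) * opTensor (π 1) (σ b')
    rw [← opTensor_mul, ← map_mul, ← map_mul, mul_one]
  map_star' b := Subtype.ext <| by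
    change opTensor (π 1) (σ (star b)) = star (opTensor (π 1) (σ b))
    rw [star_opTensor, ← map_star, ← map_star, star_one]

theorem hasFaithfulTrace_of_minTensor (hπ : Function.Injective π) (hσ : Function.Injective σ)
    (h : HasFaithfulTrace (minTensor π σ)) : HasFaithfulTrace A ∧ HasFaithfulTrace B := by
  -- Otherwise every elementary tensor vanishes and so does the unit of `minTensor`. These vectors
  -- give nontriviality of both factors and injectivity of both embeddings.
  have hxy : ∃ (x : H) (y : K), x ≠ 0 ∧ y ≠ 0 := by
    have := h.nontrivial
    by_contra! hxy
    refine one_ne_zero (α := minTensor π σ) (Subtype.ext (HilbertTensor.clm_ext fun x y => ?_))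
    change HilbertTensor.tmul x y = 0
    rw [← norm_eq_zero, HilbertTensor.norm_tmul, mul_eq_zero, norm_eq_zero, norm_eq_zero]
    exact or_iff_not_imp_left.2 (hxy x y)
  obtain ⟨x, y, hx, hy⟩ := hxy
  have : Nontrivial A := ⟨1, 0, fun h => hx <| by
    have := congrArg (fun a => π a x) h
    simpa using this⟩
  have : Nontrivial B := ⟨1, 0, fun h => hy <| by
    have := congrArg (fun b => σ b y) h
    simpa using this⟩
  constructor
  · refine (h.bounded.comap (inclLeft π σ) fun a a' haa => hπ ?_).normalize
    refine ContinuousLinearMap.ext fun x => sub_eq_zero.1 ?_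
    have h1 : HilbertTensor.tmul (π a x) y = HilbertTensor.tmul (π a' x) y := by
      have := DFunLike.congr_fun (congrArg Subtype.val haa) (HilbertTensor.tmul x y)
      simpa [inclLeft, opTensor_tmul] using this
    have h2 := HilbertTensor.norm_tmul (π a x - π a' x) y
    rw [← tensorLeft_apply, map_sub, sub_apply, tensorLeft_apply, tensorLeft_apply, h1, sub_self,
      norm_zero] at h2
    exact norm_eq_zero.1 ((mul_eq_zero.1 h2.symm).resolve_right (norm_ne_zero_iff.2 hy))
  · refine (h.bounded.comap (inclRight π σ) fun b b' hbb => hσ ?_).normalize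
    refine ContinuousLinearMap.ext fun y => sub_eq_zero.1 ?_
    have h1 : HilbertTensor.tmul x (σ b y) = HilbertTensor.tmul x (σ b' y) := by
      have := DFunLike.congr_fun (congrArg Subtype.val hbb) (HilbertTensor.tmul x y)
      simpa [inclRight, opTensor_tmul] using this
    have h2 := HilbertTensor.norm_tmul x (σ b y - σ b' y)
    rw [← tensorLeft_apply, map_sub, tensorLeft_apply, tensorLeft_apply, h1, sub_self,
      norm_zero] at h2
    exact norm_eq_zero.1 ((mul_eq_zero.1 h2.symm).resolve_left (norm_ne_zero_iff.2 hx))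

end MinTensor

end CStarTrace

theorem proposition6p4 {A : Type*} {B : Type*} [CStarAlgebra A] [CStarAlgebra B] :
    -- (i) Morita equivalence
    (CStarTrace.MoritaEquivalent A B →
      CStarTrace.HasFaithfulTrace A → CStarTrace.HasFaithfulTrace B) ∧
    -- (ii) minimal tensor products, in arbitrary faithful representations
    (∀ {H : Type*} [NormedAddCommGroup H] [InnerProductSpace ℂ H] [CompleteSpace H]
      {K : Type*} [NormedAddCommGroup K] [InnerProductSpace ℂ K] [CompleteSpace K]
      (π : A →⋆ₐ[ℂ] (H →L[ℂ] H)) (σ : B →⋆ₐ[ℂ] (K →L[ℂ] K)),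
      Function.Injective π → Function.Injective σ →
      (CStarTrace.HasFaithfulTrace (CStarTrace.minTensor π σ) ↔
        CStarTrace.HasFaithfulTrace A ∧ CStarTrace.HasFaithfulTrace B)) ∧
    -- (iii) essential ideals
    (Nontrivial A → ∀ (I : Ideal A) [I.IsTwoSided] [IsClosed (I : Set A)],
      CStarTrace.IsEssential I → CStarTrace.HasFaithfulBoundedTrace (CStarTrace.idealAlgebra I) →
      CStarTrace.HasFaithfulTrace A) ∧
    -- (iii) multiplier algebras
    (∀ (J : Type*) [NonUnitalCStarAlgebra J],
      CStarTrace.HasFaithfulTrace J ↔ CStarTrace.HasFaithfulTrace 𝓜(ℂ, J)) ∧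
    -- (iv) ideals and quotients
    (∀ (I : Ideal A) [I.IsTwoSided] [IsClosed (I : Set A)],
      CStarTrace.HasFaithfulTrace (CStarTrace.idealAlgebra I) →
      CStarTrace.HasFaithfulTrace (A ⧸ I) → CStarTrace.HasFaithfulTrace A) := by
  refine ⟨?_, ?_, ?_, fun J _ => CStarTrace.hasFaithfulTrace_multiplier_iff J, ?_⟩
  · rintro ⟨X, _, _, _, _, _, _, _, _, ⟨E⟩⟩ h
    exact E.hasFaithfulTrace h
  · intro H _ _ _ K _ _ _ π σ hπ hσ
    exact ⟨CStarTrace.hasFaithfulTrace_of_minTensor hπ hσ,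
      fun h => CStarTrace.hasFaithfulTrace_minTensor hπ hσ h.1 h.2⟩
  · intro hA I _ _ hI h
    exact CStarTrace.hasFaithfulTrace_of_essential I hI h
  · intro I _ _ h hQ
    exact CStarTrace.hasFaithfulTrace_of_ideal_quotient I h hQ
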